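/- **Definitions.** Let $S$ be a set. A presentation $(S;R)$ is *right-triangular* if there are $S'\subseteq S$ and maps $N:S'\to S$ and $C:S'\to S^*\setminus\{\varepsilon\}$ such that $N$ is injective, no letter $s$ satisfies $N^i(s)=s$ for some $i\ge 1$, and $R$ consists of the relations $N(s)=s\,C(s)$ for $s\in S'$. It is *left-triangular* if, symmetrically, $R$ consists of relations $\widetilde N(s)=\widetilde C(s)\,s$ for $s$ in some $S''\subseteq S$, where $\widetilde N$ and $\widetilde C$ satisfy the same conditions. It is *triangular* if it is both. Let $\langle S\mid R\rangle^+$ and $\langle S\mid R\rangle$ be the monoid and the group presented by $(S;R)$. In a monoid, $g\preceq h$ means $h=gk$ for some $k$ ($g$ is a left-divisor of $h$), and $h\succeq g$ means $h=kg$ for some $k$ ($g$ is a right-divisor of $h$). The space $\mathrm{LO}(G)$ is the set of left-invariant (strict linear) orderings of $G$ with the coarsest topology for which every set $\{< \,:\, a<b\}$ ($a,b\in G$) is open. Let $\widehat R$ be the set of all relations $N^i(s)=s\,C(s)C(N(s))\cdots C(N^{i-1}(s))$ with $i\ge1$, and $\check R$ the set of all relations $\widetilde N^i(s)=\widetilde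 C(\widetilde N^{i-1}(s))\cdots\widetilde C(s)\,s$ with $i\ge 1$. A *right-reversing step* on a word in the letters $s,s^{-1}$ ($s\in S$) replaces a factor $s^{-1}s'$ with $v'v^{-1}$, where $sv'=s'v$ is (up to exchanging its two sides) a relation of $\widehat R$, or deletes a factor $s^{-1}s$. A *left-reversing step* replaces a factor $s's^{-1}$ with $v^{-1}v'$, where $vs'=v's$ is (up to exchanging its two sides) a relation of $\check R$, or deletes a factor $ss^{-1}$. The *double reversing procedure* right-reverses a word $w$ into a word $vu^{-1}$ with $u,v\in S^*$, then left-reverses $vu^{-1}$ into a word $u'^{-1}v'$ with $u',v'\in S^*$; it answers "$[w]<1$" if $u'\neq\varepsilon$ and $v'=\varepsilon$, "$[w]=1$" if $u'=v'=\varepsilon$, and "$[w]>1$" if $u'=\varepsilon$ and $v'\ne\varepsilon$. Here $[w]$ is the element of the group represented by $w$. **Theorem 6.5.** Let $G$ be a group that admits a triangular presentation $(S;R)$. Assume that the monoid $\langle S\mid R\rangle^+$ contains elements $\Delta,\widetilde\Delta$ such that * $s\preceq\Delta\preceq s\Delta$ for every $s\in S$, or $s\Delta^n\preceq\Delta^{n+1}$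 for every $s\in S$ and every $n\geq0$; and * $\widetilde\Delta s\succeq\widetilde\Delta\succeq s$ for every $s\in S$, or $\widetilde\Delta^{n+1}\succeq\widetilde\Delta^n s$ for every $s\in S$ and every $n\ge0$. Then the subsemigroup of $G$ generated by $S$ is the positive cone of a left-invariant ordering $<$ on $G$. If $S$ is finite, this ordering is an isolated point of $\mathrm{LO}(G)$. The double reversing procedure decides the ordering: no infinite sequence of right-reversing steps and no infinite sequence of left-reversing steps exists, every word right-reverses to some $vu^{-1}$ and left-reverses to some $u'^{-1}v'$ with $u,v,u',v'\in S^*$, and, for every input $w$, every output $(u',v')$ of the procedure falls in one of its three cases and the answer is correct for $<$. If $S$ is finite, or if $S$ is coded by natural numbers so that $R$ is recursive (or just recursively enumerable), then the word problem of $G$ (given a word $w$ in the letters $s^{\pm1}$, decide whether $[w]=1$) and the decision problem of the ordering (given two such words $w_1,w_2$, decide whether $[w_1]<[w_2]$) are decidable. -/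

import Mathlib

/-- Relations `u = v` between words in the alphabet `S`: `R u v` means that `u = v` belongs to `R`. -/
abbrev WordRelations (S : Type*) := FreeMonoid S → FreeMonoid S → Prop

/-- `R` consists of the relations `N(s) = s C(s)` for `s` in a set `dom` of letters, where `N` is
injective on `dom`, the words `C(s)` are nonempty, and no letter is reached from itself by
iterating `N` at least once (so that the letters form a union of chains under `N`; in particular
`N` has no fixpoint). The values of `N` and `C` outside `dom` are irrelevant. -/
def IsRightTriangular {S : Type*} (R : WordRelations S) : Prop :=
  ∃ (dom : Set S) (N : S → S) (C : S → FreeMonoid S),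
    Set.InjOn N dom ∧
    (∀ s ∈ dom, C s ≠ 1) ∧
    (∀ s, ¬ Relation.TransGen (fun t t' => t ∈ dom ∧ N t = t') s s) ∧
    ∀ u v, R u v ↔ ∃ s ∈ dom, u = FreeMonoid.of (N s) ∧ v = FreeMonoid.of s * C s

/-- The mirror image of `IsRightTriangular`: the relations are `N(s) = C(s) s`. -/
def IsLeftTriangular {S : Type*} (R : WordRelations S) : Prop :=
  ∃ (dom : Set S) (N : S → S) (C : S → FreeMonoid S),
    Set.InjOn N dom ∧
    (∀ s ∈ dom, C s ≠ 1) ∧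
    (∀ s, ¬ Relation.TransGen (fun t t' => t ∈ dom ∧ N t = t') s s) ∧
    ∀ u v, R u v ↔ ∃ s ∈ dom, u = FreeMonoid.of (N s) ∧ v = C s * FreeMonoid.of s

/-- A presentation is triangular if it is both right-triangular and left-triangular. -/
def IsTriangular {S : Type*} (R : WordRelations S) : Prop :=
  IsRightTriangular R ∧ IsLeftTriangular R

/-- The relators `u v⁻¹`, for `u = v` in `R`, of the group presented by `(S; R)`. -/
def groupRelators {S : Type*} (R : WordRelations S) : Set (FreeGroup S) :=
  {r | ∃ u v, R u v ∧
    r = FreeMonoid.lift FreeGroup.of u * (FreeMonoid.lift FreeGroup.of v)⁻¹}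

/-- A left-invariant (strict, linear) ordering on a group. -/
@[ext] structure LeftOrder (G : Type*) [Group G] where
  lt : G → G → Prop
  irrefl : ∀ a, ¬ lt a a
  trans : ∀ a b c, lt a b → lt b c → lt a c
  total : ∀ a b, lt a b ∨ a = b ∨ lt b a
  mul_left : ∀ c a b, lt a b → lt (c * a) (c * b)

/-- The positive cone of a left-invariant ordering. -/
def LeftOrder.positiveCone {G : Type*} [Group G] (o : LeftOrder G) : Set G := {g | o.lt 1 g}

/-- The topology of the space `LO(G)` of left-invariant orderings: the coarsest one for which
all the sets `{< | a < b}` are open. -/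
instance LeftOrder.instTopologicalSpace {G : Type*} [Group G] : TopologicalSpace (LeftOrder G) :=
  TopologicalSpace.generateFrom {U | ∃ a b : G, U = {o | o.lt a b}}

/-- A signed word: `(s, true)` is the letter `s` and `(s, false)` is the letter `s⁻¹`. -/
abbrev SignedWord (S : Type*) := List (S × Bool)

/-- A word `u` as a signed word. -/
def posWord {S : Type*} (u : FreeMonoid S) : SignedWord S := u.toList.map fun s => (s, true)

/-- The signed word `u⁻¹`, for `u` a word. -/
def negWord {S : Type*} (u : FreeMonoid S) : SignedWord S :=
  u.toList.reverse.map fun s => (s, false)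

/-- One step of right-reversing with respect to `R`: a factor `s⁻¹ s'` is replaced with `v' v⁻¹`,
where `s v' = s' v` is a relation of `R` (read in either direction), or `s⁻¹ s` is deleted. -/
inductive RightReversingStep {S : Type*} (R : WordRelations S) :
    SignedWord S → SignedWord S → Prop
  | rel (w₁ w₂ : SignedWord S) (s s' : S) (v v' : FreeMonoid S)
      (h : R (FreeMonoid.of s * v') (FreeMonoid.of s' * v) ∨
        R (FreeMonoid.of s' * v) (FreeMonoid.of s * v')) :
      RightReversingStep R (w₁ ++ [(s, false), (s', true)] ++ w₂)
        (w₁ ++ posWord v' ++ negWord v ++ w₂)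
  | cancel (w₁ w₂ : SignedWord S) (s : S) :
      RightReversingStep R (w₁ ++ [(s, false), (s, true)] ++ w₂) (w₁ ++ w₂)

/-- One step of left-reversing with respect to `R`: a factor `s' s⁻¹` is replaced with `v⁻¹ v'`,
where `v s' = v' s` is a relation of `R` (read in either direction), or `s s⁻¹` is deleted. -/
inductive LeftReversingStep {S : Type*} (R : WordRelations S) :
    SignedWord S → SignedWord S → Prop
  | rel (w₁ w₂ : SignedWord S) (s s' : S) (v v' : FreeMonoid S)
      (h : R (v * FreeMonoid.of s') (v' * FreeMonoid.of s) ∨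
        R (v' * FreeMonoid.of s) (v * FreeMonoid.of s')) :
      LeftReversingStep R (w₁ ++ [(s', true), (s, false)] ++ w₂)
        (w₁ ++ negWord v ++ posWord v' ++ w₂)
  | cancel (w₁ w₂ : SignedWord S) (s : S) :
      LeftReversingStep R (w₁ ++ [(s, true), (s, false)] ++ w₂) (w₁ ++ w₂)

/-- For `R` consisting of the relations `N(s) = s C(s)`, this is the family of all relations
`Nⁱ(s) = s C(s) C(N(s)) ⋯ C(Nⁱ⁻¹(s))` with `i ≥ 1`. -/
inductive rightCompletion {S : Type*} (R : WordRelations S) : WordRelations S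
  | base (u v : FreeMonoid S) (h : R u v) : rightCompletion R u v
  | step (s t t' : S) (w w' : FreeMonoid S)
      (h : rightCompletion R (FreeMonoid.of t) (FreeMonoid.of s * w))
      (h' : R (FreeMonoid.of t') (FreeMonoid.of t * w')) :
      rightCompletion R (FreeMonoid.of t') (FreeMonoid.of s * (w * w'))

/-- For `R` consisting of the relations `N(s) = C(s) s`, this is the family of all relations
`Nⁱ(s) = C(Nⁱ⁻¹(s)) ⋯ C(N(s)) C(s) s` with `i ≥ 1`. -/
inductive leftCompletion {S : Type*} (R : WordRelations S) : WordRelations S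
  | base (u v : FreeMonoid S) (h : R u v) : leftCompletion R u v
  | step (s t t' : S) (w w' : FreeMonoid S)
      (h : leftCompletion R (FreeMonoid.of t) (w * FreeMonoid.of s))
      (h' : R (FreeMonoid.of t') (w' * FreeMonoid.of t)) :
      leftCompletion R (FreeMonoid.of t') ((w' * w) * FreeMonoid.of s)

/-- The double reversing procedure, with input a signed word `w` and output `(u', v')`:
right-reverse `w` into `v u⁻¹`, then left-reverse `v u⁻¹` into `u'⁻¹ v'`, with `u, v, u', v'`
words without negative letters. -/
def DoubleReversing {S : Type*} (R : WordRelations S) (w : SignedWord S) (u' v' : FreeMonoid S) :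
    Prop :=
  ∃ u v : FreeMonoid S,
    Relation.ReflTransGen (RightReversingStep (rightCompletion R)) w (posWord v ++ negWord u) ∧
    Relation.ReflTransGen (LeftReversingStep (leftCompletion R)) (posWord v ++ negWord u)
      (negWord u' ++ posWord v')

/-- The double reversing procedure decides the ordering `o` of `G`, where `val w` is the element
of `G` represented by the signed word `w`. -/
structure DoubleReversingDecides {S : Type*} (R : WordRelations S) {G : Type*} [Group G]
    (val : SignedWord S → G) (o : LeftOrder G) : Prop where
  /-- There is no infinite right-reversing sequence. -/
  right_terminates : WellFounded fun w' w => RightReversingStep (rightCompletion R) w w'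
  /-- There is no infinite left-reversing sequence. -/
  left_terminates : WellFounded fun w' w => LeftReversingStep (leftCompletion R) w w'
  /-- Right-reversing never gets stuck before reaching a word `v u⁻¹`. -/
  right_total : ∀ w, ∃ u v : FreeMonoid S,
    Relation.ReflTransGen (RightReversingStep (rightCompletion R)) w (posWord v ++ negWord u)
  /-- Left-reversing never gets stuck before reaching a word `u'⁻¹ v'`. -/
  left_total : ∀ w, ∃ u' v' : FreeMonoid S,
    Relation.ReflTransGen (LeftReversingStep (leftCompletion R)) w (negWord u' ++ posWord v')
  /-- The answer read on the output `(u', v')` is correct. -/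
  correct : ∀ w u' v', DoubleReversing R w u' v' →
    (u' ≠ 1 ∧ v' = 1 ∧ o.lt (val w) 1) ∨
    (u' = 1 ∧ v' = 1 ∧ val w = 1) ∨
    (u' = 1 ∧ v' ≠ 1 ∧ o.lt 1 (val w))

/-- The element of `G` represented by a signed word, for `G` a group presented by `(S; R)` through
the isomorphism `e`. -/
def wordValue {S : Type*} {R : WordRelations S} {G : Type*} [Group G]
    (e : PresentedGroup (groupRelators R) ≃* G) (w : SignedWord S) : G :=
  e (PresentedGroup.mk (groupRelators R) (FreeGroup.mk w))

/-- `R` is recursively enumerable, with respect to a coding of the alphabet by natural numbers. -/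
def IsREPresentation {S : Type*} [Primcodable S] (R : WordRelations S) : Prop :=
  REPred fun p : List S × List S => R (FreeMonoid.ofList p.1) (FreeMonoid.ofList p.2)

/-! Read each relation N(s) = s C(s) as a rewriting rule N(s) → s C(s). Since N is an injective
partial map without cycles, the letters split into chains, every letter has at most one rule, and no
letter comes back as a head of what it rewrites to. Leftmost derivations are then confluent, so two
words are equal in the monoid exactly when they have a common derivative
(`IsRightTriangular.conGen_iff`). Counting rules gives left cancellativity (`Derives.cancel_left`),
and the same count bounds the right-reversing of u⁻¹v whenever u and v have a common right-multiple
(`IsChainSystem.exists_reverses_of_derives`).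

The elements Δ and Δ' provide common right- and left-multiples (`exists_common_right_multiple`).
Hence every signed word has one terminating right-reversing sequence; as reversing steps satisfy a
one-step diamond property, all sequences terminate. Reading words backwards transfers all this to
left-reversing and gives right cancellativity.

By Ore's theorem the monoid embeds in G (`posWord_value_injective`), so no nonempty positive word
has value 1. For totality, every element is some vu⁻¹. In a reversing step the replacing word is
purely positive or purely negative, so left-reversing keeps the shape vu⁻¹; since it ends in a word
u'⁻¹v', one of u', v' is empty (`IsLeftTriangular.eq_one_or_eq_one_of_reflTransGen`). So each
element or its inverse is the value of a positive word, and the procedure reads off the sign.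

When S is finite, finitely many conditions 1 < s determine the cone, whence isolation. For
decidability, the sets [w] < 1, [w] = 1 and [w] > 1 are recursively enumerable, disjoint and
exhaustive. -/

/-- A system of rules `t → s c` rewriting letters, in which every letter is the left-hand side of at
most one rule, two letters never rewrite into words with the same head, and no letter is the head
of a word properly derived from it. -/
structure IsChainSystem {S : Type*} (ρ : S → S → List S → Prop) : Prop where
  rule_unique : ∀ {t s s' c c'}, ρ t s c → ρ t s' c' → s = s' ∧ c = c'
  source_unique : ∀ {t t' s c c'}, ρ t s c → ρ t' s c' → t = t'
  acyclic : ∀ s, ¬ Relation.TransGen (fun t s => ∃ c, ρ t s c) s s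

/-- `Derives ρ n u w`: the word `w` is obtained from `u` by a leftmost derivation applying `n`
rules. -/
inductive Derives {S : Type*} (ρ : S → S → List S → Prop) : ℕ → List S → List S → Prop
  | nil : Derives ρ 0 [] []
  | cons {n u w} (s : S) (h : Derives ρ n u w) : Derives ρ n (s :: u) (s :: w)
  | rule {n t s c u w} (hr : ρ t s c) (h : Derives ρ n (s :: (c ++ u)) w) :
      Derives ρ (n + 1) (t :: u) w

/-- The rules composed from a nonempty sequence of rules that each rewrite the head of the previous
result. -/
inductive Composite {S : Type*} (ρ : S → S → List S → Prop) : S → S → List S → Prop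
  | base {t s c} (h : ρ t s c) : Composite ρ t s c
  | step {t' t s w w'} (h : Composite ρ t s w) (h' : ρ t' t w') : Composite ρ t' s (w ++ w')

/-! ### Leftmost derivations: confluence, cancellation, chains of letters -/

section Derives

variable {S : Type*} {ρ : S → S → List S → Prop}

namespace Derives

theorem refl : ∀ u : List S, Derives ρ 0 u u
  | [] => nil
  | s :: u => cons s (refl u)

theorem append {n m : ℕ} {u w u' w' : List S} (h : Derives ρ n u w) (h' : Derives ρ m u' w') :
    Derives ρ (n + m) (u ++ u') (w ++ w') := by
  induction h with
  | nil => simpa using h'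
  | cons s _ ih => exact cons s ih
  | @rule n t s c u w hr _ ih =>
    rw [Nat.add_right_comm]
    exact rule hr (by simpa using ih)

/-- A rule applied to the head after the tail was rewritten can be moved before it, so a composition
can be put in leftmost form again without changing the number of rules. -/
theorem trans {n m : ℕ} {u v w : List S} (h : Derives ρ n u v) (h' : Derives ρ m v w) :
    Derives ρ (n + m) u w := by
  induction m using Nat.strong_induction_on generalizing n u v w with
  | _ m IH =>
    induction h generalizing w with
    | nil => simpa using h'
    | @cons n u v s h ih =>
      cases h' with
      | cons _ h' => exact cons s (ih h')
      | @rule m _ s₁ c _ _ hr h' =>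
        have h₁ := IH m (Nat.lt_succ_self m) ((refl (ρ := ρ) (s₁ :: c)).append h) (by simpa using h')
        rw [Nat.zero_add] at h₁
        exact rule hr (by simpa using h₁)
    | rule hr _ ih =>
      rw [Nat.add_right_comm]
      exact rule hr (ih h')

theorem length_pos {n : ℕ} {u w : List S} (h : Derives ρ n u w) (hu : u ≠ []) : w ≠ [] := by
  induction h with
  | nil => exact hu
  | cons s _ _ => simp
  | rule _ _ ih => exact ih (by simp)

theorem head {n : ℕ} {t s : S} {u w : List S} (h : Derives ρ n (t :: u) (s :: w)) :
    Relation.ReflTransGen (fun t s => ∃ c, ρ t s c) t s := by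
  generalize hx : t :: u = x at h
  generalize hy : s :: w = y at h
  induction h generalizing t u with
  | nil => cases hx
  | cons r _ _ =>
    cases hx
    cases hy
    exact .refl
  | rule hr _ ih =>
    cases hx
    exact .head ⟨_, hr⟩ (ih rfl hy)

variable (hρ : IsChainSystem ρ)
include hρ

/-- The only divergence is that one derivation keeps the head and the other rewrites it; as the rule
for that letter is unique, the first can catch up by applying it. Each such move lowers the total
number of rules still to be compared. -/
theorem confluent {n m : ℕ} {u w w' : List S} (h : Derives ρ n u w) (h' : Derives ρ m u w') :
    ∃ k l z, Derives ρ k w z ∧ Derives ρ l w' z := by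
  obtain ⟨N, hN⟩ : ∃ N, n + m = N := ⟨_, rfl⟩
  induction N using Nat.strong_induction_on generalizing n m u w w' with
  | _ N IH =>
    induction u generalizing w w' with
    | nil =>
      cases h
      cases h'
      exact ⟨0, 0, [], nil, nil⟩
    | cons t u ih =>
      cases h with
      | cons _ h =>
        cases h' with
        | cons _ h' =>
          obtain ⟨k, l, z, h₁, h₂⟩ := ih h h'
          exact ⟨k, l, t :: z, cons t h₁, cons t h₂⟩
        | @rule m _ s c _ _ hr h' =>
          have h₁ := (refl (ρ := ρ) (s :: c)).append h
          obtain ⟨k, l, z, h₂, h₃⟩ := IH (0 + n + m) (by omega) (by simpa using h₁) h' rfl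
          exact ⟨k + 1, l, z, rule hr (by simpa using h₂), h₃⟩
      | @rule n _ s c _ _ hr h =>
        cases h' with
        | cons _ h' =>
          have h₁ := (refl (ρ := ρ) (s :: c)).append h'
          obtain ⟨k, l, z, h₂, h₃⟩ := IH (n + (0 + m)) (by omega) h (by simpa using h₁) rfl
          exact ⟨k, l + 1, z, h₂, rule hr (by simpa using h₃)⟩
        | rule hr' h' =>
          obtain ⟨rfl, rfl⟩ := hρ.rule_unique hr hr'
          exact IH _ (by omega) h h' rfl

/-- If just one derivation rewrote the first letter t, the common result would start with t, and t
would be reached from itself. So both keep t or both apply its unique rule. Besides left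
cancellation, the bound on the number of rules is what makes reversing terminate. -/
theorem cancel_left {a b : ℕ} {c u v w : List S} (h : Derives ρ a (c ++ u) w)
    (h' : Derives ρ b (c ++ v) w) :
    ∃ a' b' w', a' + b' ≤ a + b ∧ Derives ρ a' u w' ∧ Derives ρ b' v w' := by
  obtain ⟨N, hN⟩ : ∃ N, a + b = N := ⟨_, rfl⟩
  induction N using Nat.strong_induction_on generalizing a b c u v w with
  | _ N IH =>
    induction c generalizing w with
    | nil => exact ⟨a, b, w, le_rfl, h, h'⟩
    | cons t c ih =>
      cases h with
      | cons _ h =>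
        cases h' with
        | cons _ h' => exact ih h h'
        | rule hr h' => exact (hρ.acyclic t (.head' ⟨_, hr⟩ h'.head)).elim
      | @rule a _ s d _ _ hr h =>
        cases h' with
        | cons _ h' => exact (hρ.acyclic t (.head' ⟨_, hr⟩ h.head)).elim
        | @rule b _ _ _ _ _ hr' h' =>
          obtain ⟨rfl, rfl⟩ := hρ.rule_unique hr hr'
          obtain ⟨a', b', w', hle, h₁, h₂⟩ :=
            IH (a + b) (by omega) (c := s :: (d ++ c)) (by simpa using h) (by simpa using h') rfl
          exact ⟨a', b', w', by omega, h₁, h₂⟩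

end Derives

theorem Composite.transGen {t s : S} {k : List S} (h : Composite ρ t s k) :
    Relation.TransGen (fun t s => ∃ c, ρ t s c) t s := by
  induction h with
  | base h => exact .single ⟨_, h⟩
  | step _ h' ih => exact .head ⟨_, h'⟩ ih

theorem Composite.exists_of_transGen {t s : S}
    (h : Relation.TransGen (fun t s => ∃ c, ρ t s c) t s) : ∃ k, Composite ρ t s k := by
  induction h using Relation.TransGen.head_induction_on with
  | single h => exact h.imp fun _ => .base
  | head h' _ ih =>
    obtain ⟨k, hk⟩ := ih
    obtain ⟨c, hc⟩ := h'
    exact ⟨k ++ c, .step hk hc⟩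

namespace IsChainSystem

variable (hρ : IsChainSystem ρ)
include hρ

theorem composite_unique {t s : S} {k k' : List S} (h : Composite ρ t s k)
    (h' : Composite ρ t s k') : k = k' := by
  induction h generalizing k' with
  | base h =>
    cases h' with
    | base h' => exact (hρ.rule_unique h h').2
    | step h₁ h₂ =>
      obtain ⟨rfl, -⟩ := hρ.rule_unique h h₂
      exact (hρ.acyclic _ h₁.transGen).elim
  | step h₁ h₂ ih =>
    cases h' with
    | base h' =>
      obtain ⟨rfl, -⟩ := hρ.rule_unique h' h₂
      exact (hρ.acyclic _ h₁.transGen).elim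
    | step h₃ h₄ =>
      obtain ⟨rfl, rfl⟩ := hρ.rule_unique h₂ h₄
      rw [ih h₃]

/-- Going up from h there is at most one letter at each stage, so s and t lie on one chain above h.
-/
theorem composite_total {s t h : S} (hs : Relation.ReflTransGen (fun t s => ∃ c, ρ t s c) s h)
    (ht : Relation.ReflTransGen (fun t s => ∃ c, ρ t s c) t h) :
    s = t ∨ (∃ k, Composite ρ t s k) ∨ ∃ k, Composite ρ s t k := by
  have hs' := Relation.reflTransGen_swap.2 hs
  have ht' := Relation.reflTransGen_swap.2 ht
  have key := Relation.ReflTransGen.total_of_right_unique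
    (fun a b c ⟨_, h₁⟩ ⟨_, h₂⟩ => hρ.source_unique h₁ h₂) hs' ht'
  rcases key with h₁ | h₁
  · rcases Relation.reflTransGen_iff_eq_or_transGen.1 (Relation.reflTransGen_swap.1 h₁) with h | h
    · exact .inl h
    · exact .inr (.inl (Composite.exists_of_transGen h))
  · rcases Relation.reflTransGen_iff_eq_or_transGen.1 (Relation.reflTransGen_swap.1 h₁) with h | h
    · exact .inl h.symm
    · exact .inr (.inr (Composite.exists_of_transGen h))

/-- As r is reachable from s, acyclicity forbids stopping at a letter above s: the derivation has to
begin with the rules composing t → s k. There is at least one of them, and omitting them makes the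
count strictly smaller. -/
theorem derives_of_composite {t s r : S} {k z w : List S} {b : ℕ} (hk : Composite ρ t s k)
    (h : Derives ρ b (t :: z) (r :: w))
    (hr : Relation.ReflTransGen (fun t s => ∃ c, ρ t s c) s r) :
    ∃ b', b' < b ∧ Derives ρ b' (s :: (k ++ z)) (r :: w) := by
  induction hk generalizing b z with
  | @base t s c hc =>
    cases h with
    | cons _ h => exact (hρ.acyclic _ (.head' ⟨_, hc⟩ hr)).elim
    | rule hc' h =>
      obtain ⟨rfl, rfl⟩ := hρ.rule_unique hc hc'
      exact ⟨_, Nat.lt_succ_self _, h⟩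
  | @step t' t s k k' hk hk' ih =>
    cases h with
    | cons _ h => exact (hρ.acyclic _ (.head' ⟨_, hk'⟩ (hk.transGen.to_reflTransGen.trans hr))).elim
    | rule hc' h =>
      obtain ⟨rfl, rfl⟩ := hρ.rule_unique hk' hc'
      obtain ⟨b', hb', h'⟩ := ih h hr
      exact ⟨b', by omega, by simpa using h'⟩

end IsChainSystem

end Derives

/-! ### Signed words and right-reversing -/

/-- `FactorReverses ρ s s' q`: right-reversing replaces the factor `s⁻¹ s'` with `q`. -/
inductive FactorReverses {S : Type*} (ρ : S → S → List S → Prop) : S → S → SignedWord S → Prop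
  | same (s : S) : FactorReverses ρ s s []
  | up {s s' k} (h : Composite ρ s' s k) : FactorReverses ρ s s' (posWord (.ofList k))
  | down {s s' k} (h : Composite ρ s s' k) : FactorReverses ρ s s' (negWord (.ofList k))

/-- One step of right-reversing, for a system of rules. -/
def Reverses {S : Type*} (ρ : S → S → List S → Prop) (w w' : SignedWord S) : Prop :=
  ∃ a b s s' q, FactorReverses ρ s s' q ∧ w = a ++ (s, false) :: (s', true) :: b ∧
    w' = a ++ (q ++ b)

section words

variable {S : Type*}

@[simp] theorem posWord_one : posWord (1 : FreeMonoid S) = [] := rfl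

@[simp] theorem negWord_one : negWord (1 : FreeMonoid S) = [] := rfl

@[simp] theorem posWord_of (s : S) : posWord (.of s) = [(s, true)] := rfl

@[simp] theorem negWord_of (s : S) : negWord (.of s) = [(s, false)] := rfl

@[simp] theorem posWord_mul (u v : FreeMonoid S) : posWord (u * v) = posWord u ++ posWord v := by
  simp [posWord]

@[simp] theorem negWord_mul (u v : FreeMonoid S) : negWord (u * v) = negWord v ++ negWord u := by
  simp [negWord]

@[simp] theorem negWord_eq_nil {u : FreeMonoid S} : negWord u = [] ↔ u = 1 := by
  simp only [negWord, List.map_eq_nil_iff, List.reverse_eq_nil_iff]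
  rfl

@[simp] theorem posWord_eq_nil {u : FreeMonoid S} : posWord u = [] ↔ u = 1 := by
  simp only [posWord, List.map_eq_nil_iff]
  rfl

theorem mem_posWord {u : FreeMonoid S} {x : S × Bool} (h : x ∈ posWord u) : x.2 = true := by
  obtain ⟨s, _, rfl⟩ := List.mem_map.1 h
  rfl

theorem mem_negWord {u : FreeMonoid S} {x : S × Bool} (h : x ∈ negWord u) : x.2 = false := by
  obtain ⟨s, _, rfl⟩ := List.mem_map.1 h
  rfl

theorem exists_eq_posWord {w : SignedWord S} (h : ∀ x ∈ w, x.2 = true) :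
    ∃ u : FreeMonoid S, w = posWord u := by
  refine ⟨.ofList (w.map Prod.fst), ?_⟩
  simp only [posWord, FreeMonoid.toList_ofList, List.map_map]
  exact (List.map_id _).symm.trans (List.map_congr_left fun x hx => Prod.ext rfl (h x hx))

theorem exists_eq_negWord {w : SignedWord S} (h : ∀ x ∈ w, x.2 = false) :
    ∃ u : FreeMonoid S, w = negWord u := by
  refine ⟨.ofList (w.map Prod.fst).reverse, ?_⟩
  simp only [negWord, FreeMonoid.toList_ofList, List.reverse_reverse, List.map_map]
  exact (List.map_id _).symm.trans (List.map_congr_left fun x hx => Prod.ext rfl (h x hx))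

theorem ofList_cons' (s : S) (l : List S) : FreeMonoid.ofList (s :: l) = .of s * .ofList l := rfl

end words

section Reverses

variable {S : Type*} {ρ : S → S → List S → Prop}

theorem FactorReverses.reverses {s s' : S} {q : SignedWord S} (h : FactorReverses ρ s s' q)
    (a b : SignedWord S) : Reverses ρ (a ++ (s, false) :: (s', true) :: b) (a ++ (q ++ b)) :=
  ⟨a, b, s, s', q, h, rfl, rfl⟩

theorem Reverses.append_append {w w' : SignedWord S} (h : Reverses ρ w w') (x y : SignedWord S) :
    Reverses ρ (x ++ (w ++ y)) (x ++ (w' ++ y)) := by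
  obtain ⟨a, b, s, s', q, hq, rfl, rfl⟩ := h
  simpa using hq.reverses (x ++ a) (b ++ y)

theorem Reverses.reflTransGen_append_append {w w' : SignedWord S}
    (h : Relation.ReflTransGen (Reverses ρ) w w') (x y : SignedWord S) :
    Relation.ReflTransGen (Reverses ρ) (x ++ (w ++ y)) (x ++ (w' ++ y)) :=
  h.lift (fun w => x ++ (w ++ y)) fun _ _ h => h.append_append x y

namespace IsChainSystem

variable (hρ : IsChainSystem ρ)
include hρ

theorem factorReverses_unique {s s' : S} {q q' : SignedWord S} (h : FactorReverses ρ s s' q)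
    (h' : FactorReverses ρ s s' q') : q = q' := by
  cases h with
  | same =>
    cases h' with
    | same => rfl
    | up h => exact (hρ.acyclic _ h.transGen).elim
    | down h => exact (hρ.acyclic _ h.transGen).elim
  | up h =>
    cases h' with
    | same => exact (hρ.acyclic _ h.transGen).elim
    | up h' => rw [hρ.composite_unique h h']
    | down h' => exact (hρ.acyclic _ (h.transGen.trans h'.transGen)).elim
  | down h =>
    cases h' with
    | same => exact (hρ.acyclic _ h.transGen).elim
    | up h' => exact (hρ.acyclic _ (h.transGen.trans h'.transGen)).elim
    | down h' => rw [hρ.composite_unique h h']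

/-- A reversible factor is a negative letter followed by a positive one, so two of them cannot
overlap in a single letter: they coincide, with the same replacement, or are disjoint, and the steps
commute. -/
theorem reverses_diamond {w w₁ w₂ : SignedWord S} (h₁ : Reverses ρ w w₁) (h₂ : Reverses ρ w w₂) :
    w₁ = w₂ ∨ ∃ z, Reverses ρ w₁ z ∧ Reverses ρ w₂ z := by
  have key : ∀ {a m d : SignedWord S} {s s' t t' : S} {q r : SignedWord S},
      FactorReverses ρ s s' q → FactorReverses ρ t t' r →
      ∃ z, Reverses ρ (a ++ (q ++ (m ++ (t, false) :: (t', true) :: d))) z ∧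
        Reverses ρ ((a ++ (s, false) :: (s', true) :: m) ++ (r ++ d)) z := by
    intro a m d s s' t t' q r hq hr
    refine ⟨a ++ (q ++ (m ++ (r ++ d))), ?_, ?_⟩
    · simpa using hr.reverses (a ++ (q ++ m)) d
    · simpa using hq.reverses a (m ++ (r ++ d))
  obtain ⟨a, b, s, s', q, hq, rfl, rfl⟩ := h₁
  obtain ⟨c, d, t, t', r, hr, he, rfl⟩ := h₂
  rcases List.append_eq_append_iff.1 he with ⟨m, rfl, hm⟩ | ⟨m, rfl, hm⟩
  · match m with
    | [] =>
      obtain ⟨⟨rfl, -⟩, ⟨rfl, -⟩, rfl⟩ : (s = t ∧ True) ∧ (s' = t' ∧ True) ∧ b = d := by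
        simpa using hm
      simp [hρ.factorReverses_unique hq hr]
    | [_] => simp at hm
    | x :: y :: m =>
      simp only [List.cons_append, List.cons.injEq] at hm
      obtain ⟨rfl, rfl, rfl⟩ := hm
      exact .inr (key hq hr)
  · match m with
    | [] =>
      obtain ⟨⟨rfl, -⟩, ⟨rfl, -⟩, rfl⟩ : (t = s ∧ True) ∧ (t' = s' ∧ True) ∧ d = b := by
        simpa using hm
      simp [hρ.factorReverses_unique hq hr]
    | [_] => simp at hm
    | x :: y :: m =>
      simp only [List.cons_append, List.cons.injEq] at hm
      obtain ⟨rfl, rfl, rfl⟩ := hm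
      obtain ⟨z, hz, hz'⟩ := key hr hq
      exact .inr ⟨z, hz', hz⟩

/-- Words with a common right-multiple have a finite right-reversing. -/
theorem exists_reverses_of_derives {a b : ℕ} {u v x y w : List S} (h : Derives ρ a (u ++ x) w)
    (h' : Derives ρ b (v ++ y) w) :
    ∃ u' v' : FreeMonoid S, Relation.ReflTransGen (Reverses ρ)
      (negWord (.ofList u) ++ posWord (.ofList v)) (posWord v' ++ negWord u') := by
  obtain ⟨N, hN⟩ : ∃ N, a + b = N := ⟨_, rfl⟩
  obtain ⟨L, hL⟩ : ∃ L, u.length + v.length = L := ⟨_, rfl⟩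
  induction N using Nat.strong_induction_on generalizing a b u v x y w L with
  | _ N IH =>
  induction L using Nat.strong_induction_on generalizing a b u v x y w with
  | _ L IHL =>
  match u, v with
  | [], v => exact ⟨1, .ofList v, by simpa using .refl⟩
  | u, [] => exact ⟨.ofList u, 1, by simpa using .refl⟩
  | s :: u, t :: v =>
    have hcons : ∀ {q : SignedWord S}, FactorReverses ρ s t q → Reverses ρ
        (negWord (.ofList (s :: u)) ++ posWord (.ofList (t :: v)))
        (negWord (.ofList u) ++ (q ++ posWord (.ofList v))) := fun hq => by
      simpa [ofList_cons'] using hq.reverses (negWord (.ofList u)) (posWord (.ofList v))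
    match w with
    | [] => exact (h.length_pos (by simp) rfl).elim
    | r :: w =>
      -- Both heads derive the head r of the common multiple, so they are comparable. If they are
      -- equal, cancelling them shortens the words without raising the rule count; otherwise the
      -- words may grow, but the composite rule is saved and the count drops.
      rcases hρ.composite_total h.head h'.head with rfl | ⟨k, hk⟩ | ⟨k, hk⟩
      · obtain ⟨a', b', w', hle, h₁, h₂⟩ := h.cancel_left hρ (c := [s]) h'
        obtain ⟨u', v', hr⟩ : ∃ u' v' : FreeMonoid S, Relation.ReflTransGen (Reverses ρ)
            (negWord (.ofList u) ++ posWord (.ofList v)) (posWord v' ++ negWord u') := by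
          rcases hle.lt_or_eq with hlt | heq
          · exact IH _ (by omega) h₁ h₂ rfl _ rfl
          · exact IHL _ (by simp at hL; omega) h₁ h₂ (by omega) rfl
        exact ⟨u', v', .head (hcons (.same s)) (by simpa using hr)⟩
      · obtain ⟨b', hb, h''⟩ := hρ.derives_of_composite hk h' h.head
        obtain ⟨a'', b'', w', hle, h₁, h₂⟩ := h.cancel_left hρ (c := [s]) h''
        obtain ⟨u', v', hr⟩ := IH (a'' + b'') (by omega) (v := k ++ v) h₁ (by simpa using h₂) rfl
          _ rfl
        exact ⟨u', v', .head (hcons (.up hk)) (by simpa using hr)⟩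
      · obtain ⟨a', ha, h''⟩ := hρ.derives_of_composite hk h h'.head
        obtain ⟨a'', b'', w', hle, h₁, h₂⟩ := h''.cancel_left hρ (c := [t]) h'
        obtain ⟨u', v', hr⟩ := IH (a'' + b'') (by omega) (u := k ++ u) (by simpa using h₁) h₂ rfl
          _ rfl
        exact ⟨u', v', .head (hcons (.down hk)) (by simpa using hr)⟩

/-- If any two words have a common right-multiple, right-reversing never gets stuck. -/
theorem exists_reverses
    (hc : ∀ u v : List S, ∃ a b x y w, Derives ρ a (u ++ x) w ∧ Derives ρ b (v ++ y) w)
    (w : SignedWord S) :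
    ∃ u v : FreeMonoid S, Relation.ReflTransGen (Reverses ρ) w (posWord v ++ negWord u) := by
  induction w using List.reverseRecOn with
  | nil => exact ⟨1, 1, by simpa using .refl⟩
  | append_singleton w x ih =>
    obtain ⟨u, v, h⟩ := ih
    have h₁ := Reverses.reflTransGen_append_append h [] [x]
    match x with
    | (s, false) => exact ⟨.of s * u, v, by simpa using h₁⟩
    | (s, true) =>
      -- The word is now v u⁻¹ s; only its end u⁻¹ s needs reversing.
      obtain ⟨a, b, x, y, z, hx, hy⟩ := hc u.toList [s]
      obtain ⟨u', v', h₂⟩ := hρ.exists_reverses_of_derives hx hy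
      have h₃ := Reverses.reflTransGen_append_append h₂ (posWord v) []
      refine ⟨u', v * v', ?_⟩
      refine Relation.ReflTransGen.trans (by simpa using h₁) ?_
      simpa [ofList_cons'] using h₃

end IsChainSystem

theorem not_reverses_posWord_append_negWord (u v : FreeMonoid S) (w : SignedWord S) :
    ¬ Reverses ρ (posWord v ++ negWord u) w := by
  rintro ⟨a, b, s, s', q, -, h, -⟩
  rcases List.append_eq_append_iff.1 h with ⟨m, rfl, hm⟩ | ⟨m, hm, hm'⟩
  · have : (s', true) ∈ negWord u := by simp [hm]
    simpa using mem_negWord this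
  · match m with
    | [] =>
      have : (s', true) ∈ negWord u := by rw [← List.nil_append (negWord u), ← hm']; simp
      simpa using mem_negWord this
    | x :: m =>
      simp only [List.cons_append, List.cons.injEq] at hm'
      have : (s, false) ∈ posWord v := by simp [hm, ← hm'.1]
      simpa using mem_posWord this

/-- The shape `u⁻¹ v` is preserved by right-reversing. -/
theorem Reverses.negWord_append_posWord {u v : FreeMonoid S} {w : SignedWord S}
    (h : Reverses ρ (negWord u ++ posWord v) w) :
    ∃ u' v' : FreeMonoid S, w = negWord u' ++ posWord v' := by
  obtain ⟨a, b, s, s', q, hq, he, rfl⟩ := h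
  have key : negWord u = a ++ [(s, false)] ∧ posWord v = (s', true) :: b := by
    rcases List.append_eq_append_iff.1 he with ⟨m, rfl, hm⟩ | ⟨m, hm, hm'⟩
    · have : (s, false) ∈ posWord v := by simp [hm]
      simpa using mem_posWord this
    · match m with
      | [] =>
        have : (s, false) ∈ posWord v := by rw [← List.nil_append (posWord v), ← hm']; simp
        simpa using mem_posWord this
      | [x] =>
        simp only [List.cons_append, List.nil_append, List.cons.injEq] at hm'
        exact ⟨by rw [hm, hm'.1], hm'.2.symm⟩
      | x :: y :: m =>
        simp only [List.cons_append, List.cons.injEq] at hm'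
        have : (s', true) ∈ negWord u := by simp [hm, ← hm'.2.1]
        simpa using mem_negWord this
  obtain ⟨u₁, rfl⟩ := exists_eq_negWord (w := a) fun x hx =>
    mem_negWord (u := u) (by simp [key.1, hx])
  obtain ⟨v₁, rfl⟩ := exists_eq_posWord (w := b) fun x hx =>
    mem_posWord (u := v) (by simp [key.2, hx])
  cases hq with
  | same => exact ⟨u₁, v₁, rfl⟩
  | @up _ k _ => exact ⟨u₁, .ofList k * v₁, by simp⟩
  | @down _ k _ => exact ⟨.ofList k * u₁, v₁, by simp⟩

theorem Reverses.reflTransGen_negWord_append_posWord {u v : FreeMonoid S} {w : SignedWord S}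
    (h : Relation.ReflTransGen (Reverses ρ) (negWord u ++ posWord v) w) :
    ∃ u' v' : FreeMonoid S, w = negWord u' ++ posWord v' := by
  induction h with
  | refl => exact ⟨u, v, rfl⟩
  | tail _ h ih =>
    obtain ⟨u', v', rfl⟩ := ih
    exact h.negWord_append_posWord

end Reverses

/-! ### From one terminating sequence to termination of all -/

section diamond

variable {α : Type*} {r : α → α → Prop}

/-- For a relation with the one-step diamond property, accessibility passes to predecessors. -/
theorem acc_of_rel_of_diamond (hd : ∀ a b c, r a b → r a c → b = c ∨ ∃ d, r b d ∧ r c d) {a b : α}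
    (hb : Acc (fun y x => r x y) b) (h : r a b) : Acc (fun y x => r x y) a := by
  induction hb generalizing a with
  | intro b hb ih =>
    refine ⟨a, fun c hc => ?_⟩
    rcases hd a b c h hc with rfl | ⟨d, hbd, hcd⟩
    · exact ⟨b, hb⟩
    · exact ih d hbd hcd

/-- One sequence reaching an irreducible element suffices: accessibility is carried back along it
step by step. The diamond has to close in at most one step on each side. -/
theorem acc_of_diamond (hd : ∀ a b c, r a b → r a c → b = c ∨ ∃ d, r b d ∧ r c d) {a z : α}
    (hz : ∀ b, ¬ r z b) (h : Relation.ReflTransGen r a z) : Acc (fun y x => r x y) a := by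
  induction h using Relation.ReflTransGen.head_induction_on with
  | refl => exact ⟨z, fun b hb => (hz b hb).elim⟩
  | head h _ ih => exact acc_of_rel_of_diamond hd ih h

end diamond

/-- The rules `t → s c` given by the relations `t = s c` of `R`. -/
def letterRule {S : Type*} (R : WordRelations S) (t s : S) (c : List S) : Prop :=
  R (.of t) (.of s * .ofList c)

/-! ### Monoids with a right-triangular presentation -/

section triangular

variable {S : Type*} {R : WordRelations S}

theorem FreeMonoid.of_mul_eq_of_mul {s s' : S} {u u' : FreeMonoid S} :
    of s * u = of s' * u' ↔ s = s' ∧ u = u' := by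
  constructor
  · intro h
    exact List.cons.inj h
  · rintro ⟨rfl, rfl⟩
    rfl

theorem FreeMonoid.of_mul_eq_of {s s' : S} {u : FreeMonoid S} :
    of s * u = of s' ↔ s = s' ∧ u = 1 := by
  rw [← mul_one (of s'), of_mul_eq_of_mul]

/-- Rules go against N: uniqueness of the rule for a letter is injectivity of N, and uniqueness of
the letter above s is that N is a function. -/
theorem IsRightTriangular.isChainSystem (h : IsRightTriangular R) :
    IsChainSystem (letterRule R) := by
  obtain ⟨dom, N, C, hN, -, hac, hR⟩ := h
  have key : ∀ {t s c}, letterRule R t s c → s ∈ dom ∧ N s = t ∧ c = (C s).toList := by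
    intro t s c h
    obtain ⟨s', hs', h₁, h₂⟩ := (hR _ _).1 h
    obtain ⟨rfl, rfl⟩ := FreeMonoid.of_mul_eq_of_mul.1 h₂
    exact ⟨hs', (FreeMonoid.of_injective h₁).symm, rfl⟩
  refine ⟨fun h h' => ?_, fun h h' => ?_, fun s h => hac s ?_⟩
  · obtain ⟨hs, rfl, rfl⟩ := key h
    obtain ⟨hs', h, rfl⟩ := key h'
    obtain rfl := hN hs' hs h
    exact ⟨rfl, rfl⟩
  · exact (key h).2.1.symm.trans (key h').2.1
  · refine Relation.transGen_swap.1 (Relation.TransGen.mono ?_ s s h)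
    rintro a b ⟨c, hc⟩
    exact ⟨(key hc).1, (key hc).2.1⟩

theorem IsRightTriangular.exists_letterRule (h : IsRightTriangular R) {u v : FreeMonoid S}
    (huv : R u v) : ∃ t s c, letterRule R t s c ∧ u = .of t ∧ v = .of s * .ofList c := by
  obtain ⟨dom, N, C, -, -, -, hR⟩ := h
  obtain ⟨s, hs, rfl, rfl⟩ := (hR _ _).1 huv
  exact ⟨N s, s, (C s).toList, huv, rfl, rfl⟩

theorem Composite.rightCompletion {t s : S} {k : List S} (h : Composite (letterRule R) t s k) :
    rightCompletion R (.of t) (.of s * .ofList k) := by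
  induction h with
  | base h => exact .base _ _ h
  | step _ h' ih => exact .step _ _ _ _ _ ih h'

theorem IsRightTriangular.rightCompletion_iff (h : IsRightTriangular R) {u v : FreeMonoid S} :
    rightCompletion R u v ↔
      ∃ t s k, Composite (letterRule R) t s k ∧ u = .of t ∧ v = .of s * .ofList k := by
  constructor
  · intro huv
    induction huv with
    | base u v huv =>
      obtain ⟨t, s, c, hc, rfl, rfl⟩ := h.exists_letterRule huv
      exact ⟨t, s, c, .base hc, rfl, rfl⟩
    | step s t t' w w' _ h' ih =>
      obtain ⟨t₁, s₁, k, hk, h₁, h₂⟩ := ih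
      obtain rfl := FreeMonoid.of_injective h₁
      obtain ⟨rfl, rfl⟩ := FreeMonoid.of_mul_eq_of_mul.1 h₂
      exact ⟨t', s, _, .step hk h', rfl, rfl⟩
  · rintro ⟨t, s, k, hk, rfl, rfl⟩
    exact hk.rightCompletion

/-- One side of each completed relation is a single letter, which forces v or v' to be empty. So the
factor is replaced with a word of constant sign. -/
theorem IsRightTriangular.rightReversingStep_iff (h : IsRightTriangular R) {w w' : SignedWord S} :
    RightReversingStep (rightCompletion R) w w' ↔ Reverses (letterRule R) w w' := by
  constructor
  · intro hw
    cases hw with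
    | cancel a b s => simpa using (FactorReverses.same s).reverses (ρ := letterRule R) a b
    | rel a b s s' v v' hv =>
      suffices FactorReverses (letterRule R) s s' (posWord v' ++ negWord v) by
        simpa using this.reverses a b
      rcases hv with hv | hv
      · obtain ⟨t, r, k, hk, h₁, h₂⟩ := h.rightCompletion_iff.1 hv
        obtain ⟨rfl, rfl⟩ := FreeMonoid.of_mul_eq_of.1 h₁
        obtain ⟨rfl, rfl⟩ := FreeMonoid.of_mul_eq_of_mul.1 h₂
        exact .down hk
      · obtain ⟨t, r, k, hk, h₁, h₂⟩ := h.rightCompletion_iff.1 hv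
        obtain ⟨rfl, rfl⟩ := FreeMonoid.of_mul_eq_of.1 h₁
        obtain ⟨rfl, rfl⟩ := FreeMonoid.of_mul_eq_of_mul.1 h₂
        rw [negWord_one, List.append_nil]
        exact .up hk
  · rintro ⟨a, b, s, s', q, hq, rfl, rfl⟩
    cases hq with
    | same => simpa using RightReversingStep.cancel (R := rightCompletion R) a b s
    | @up _ k hk =>
      simpa using RightReversingStep.rel (R := rightCompletion R) a b s s' 1 (.ofList k)
        (.inr (by simpa using hk.rightCompletion))
    | @down _ k hk =>
      simpa using RightReversingStep.rel (R := rightCompletion R) a b s s' (.ofList k) 1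
        (.inl (by simpa using hk.rightCompletion))

/-- Two words represent the same element of the monoid if and only if they have a common
derivative. -/
theorem IsRightTriangular.conGen_iff (h : IsRightTriangular R) {u v : FreeMonoid S} :
    conGen R u v ↔ ∃ n m w, Derives (letterRule R) n u.toList w ∧
      Derives (letterRule R) m v.toList w := by
  have hρ := h.isChainSystem
  constructor
  · intro huv
    induction huv with
    | of u v huv =>
      obtain ⟨t, s, c, hc, rfl, rfl⟩ := h.exists_letterRule huv
      exact ⟨1, 0, s :: c, .rule hc (by simpa using .refl _), .refl _⟩
    | refl u => exact ⟨0, 0, _, .refl _, .refl _⟩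
    | symm _ ih =>
      obtain ⟨n, m, w, h₁, h₂⟩ := ih
      exact ⟨m, n, w, h₂, h₁⟩
    | trans _ _ ih ih' =>
      obtain ⟨n, m, w, h₁, h₂⟩ := ih
      obtain ⟨n', m', w', h₁', h₂'⟩ := ih'
      obtain ⟨k, l, z, hz, hz'⟩ := h₂.confluent hρ h₁'
      exact ⟨_, _, z, h₁.trans hz, h₂'.trans hz'⟩
    | mul _ _ ih ih' =>
      obtain ⟨n, m, w, h₁, h₂⟩ := ih
      obtain ⟨n', m', w', h₁', h₂'⟩ := ih'
      exact ⟨_, _, w ++ w', h₁.append h₁', h₂.append h₂'⟩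
  · have key : ∀ {n u w}, Derives (letterRule R) n u w →
        conGen R (.ofList u) (.ofList w) := by
      intro n u w h
      induction h with
      | nil => exact (conGen R).refl _
      | cons s _ ih => exact (conGen R).mul ((conGen R).refl (.of s)) ih
      | @rule _ t s c u w hr _ ih =>
        have h₁ : conGen R (.of t * .ofList u) (.of s * .ofList c * .ofList u) :=
          (conGen R).mul (.of _ _ hr) ((conGen R).refl _)
        refine (conGen R).trans h₁ ?_
        simpa [ofList_cons', mul_assoc] using ih
    rintro ⟨n, m, w, h₁, h₂⟩
    exact (conGen R).trans (key h₁) ((conGen R).symm (key h₂))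

theorem IsRightTriangular.mul_left_cancel (h : IsRightTriangular R) {a b c : PresentedMonoid R}
    (habc : a * b = a * c) : b = c := by
  obtain ⟨u, rfl⟩ := PresentedMonoid.surjective_mk a
  obtain ⟨v, rfl⟩ := PresentedMonoid.surjective_mk b
  obtain ⟨w, rfl⟩ := PresentedMonoid.surjective_mk c
  rw [← map_mul, ← map_mul, PresentedMonoid.mk_eq_mk_iff, h.conGen_iff] at habc
  obtain ⟨n, m, z, h₁, h₂⟩ := habc
  obtain ⟨n', m', z', -, h₁', h₂'⟩ := h₁.cancel_left h.isChainSystem h₂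
  exact PresentedMonoid.mk_eq_mk_iff.2 (h.conGen_iff.2 ⟨n', m', z', h₁', h₂'⟩)

theorem IsRightTriangular.mk_eq_one (h : IsRightTriangular R) {u : FreeMonoid S}
    (hu : PresentedMonoid.mk R u = 1) : u = 1 := by
  rw [← map_one (PresentedMonoid.mk R), PresentedMonoid.mk_eq_mk_iff, h.conGen_iff] at hu
  obtain ⟨n, m, z, h₁, h₂⟩ := hu
  cases h₂
  by_contra hne
  exact h₁.length_pos hne rfl

/-- Any two elements of the monoid have a common right-multiple. -/
theorem exists_common_right_multiple {M : Type*} [Monoid M] {X : Set M}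
    (hX : Submonoid.closure X = ⊤) {Δ : M}
    (h : (∀ s ∈ X, s ∣ Δ ∧ Δ ∣ s * Δ) ∨ ∀ s ∈ X, ∀ n : ℕ, s * Δ ^ n ∣ Δ ^ (n + 1)) (a b : M) :
    ∃ c d, a * c = b * d := by
  have h₂ : ∀ s ∈ X, ∀ n : ℕ, s * Δ ^ n ∣ Δ ^ (n + 1) := by
    rcases h with h | h
    -- The first condition implies the second: Δ ∣ gΔ for all g passes to the powers of Δ, and if Δ
    -- = s x then s Δⁿ divides s x Δⁿ = Δⁿ⁺¹.
    · have h₁ : ∀ g : M, Δ ∣ g * Δ := by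
        intro g
        induction (hX ▸ Submonoid.mem_top g : g ∈ Submonoid.closure X) using
          Submonoid.closure_induction with
        | mem s hs => exact (h s hs).2
        | one => simp
        | mul x y _ _ hx hy => exact hx.trans (mul_assoc x y Δ ▸ mul_dvd_mul_left x hy)
      have hn : ∀ (n : ℕ) (g : M), Δ ^ n ∣ g * Δ ^ n := by
        intro n
        induction n with
        | zero => simp
        | succ n ih =>
          intro g
          obtain ⟨y, hy⟩ := h₁ g
          rw [pow_succ', ← mul_assoc, hy, mul_assoc]
          exact mul_dvd_mul_left Δ (ih y)
      intro s hs n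
      obtain ⟨x, hx⟩ := (h s hs).1
      rw [pow_succ']
      nth_rewrite 2 [hx]
      rw [mul_assoc]
      exact mul_dvd_mul_left s (hn n x)
    · exact h
  -- Asking this for all k at once makes it stable under products: use k for the right factor and m
  -- + k for the left one.
  have h₃ : ∀ g : M, ∃ n : ℕ, ∀ k : ℕ, g * Δ ^ k ∣ Δ ^ (n + k) := by
    intro g
    induction (hX ▸ Submonoid.mem_top g : g ∈ Submonoid.closure X) using
      Submonoid.closure_induction with
    | mem s hs => exact ⟨1, fun k => add_comm k 1 ▸ h₂ s hs k⟩
    | one => exact ⟨0, by simp⟩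
    | mul x y _ _ hx hy =>
      obtain ⟨n, hn⟩ := hx
      obtain ⟨m, hm⟩ := hy
      refine ⟨n + m, fun k => ?_⟩
      rw [mul_assoc, add_assoc]
      exact (mul_dvd_mul_left x (hm k)).trans (hn _)
  obtain ⟨n, hn⟩ := h₃ a
  obtain ⟨m, hm⟩ := h₃ b
  obtain ⟨c, hc⟩ := hn m
  obtain ⟨d, hd⟩ := hm n
  exact ⟨Δ ^ m * c, Δ ^ n * d, by rw [← mul_assoc, ← hc, ← mul_assoc, ← hd, add_comm]⟩

theorem IsRightTriangular.exists_reverses (h : IsRightTriangular R)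
    (hc : ∀ a b : PresentedMonoid R, ∃ c d, a * c = b * d) (w : SignedWord S) :
    ∃ u v : FreeMonoid S,
      Relation.ReflTransGen (Reverses (letterRule R)) w (posWord v ++ negWord u) := by
  refine h.isChainSystem.exists_reverses (fun u v => ?_) w
  obtain ⟨c, d, hcd⟩ := hc (PresentedMonoid.mk R (.ofList u)) (PresentedMonoid.mk R (.ofList v))
  obtain ⟨x, rfl⟩ := PresentedMonoid.surjective_mk c
  obtain ⟨y, rfl⟩ := PresentedMonoid.surjective_mk d
  rw [← map_mul, ← map_mul, PresentedMonoid.mk_eq_mk_iff, h.conGen_iff] at hcd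
  obtain ⟨n, m, z, h₁, h₂⟩ := hcd
  exact ⟨n, m, _, _, z, h₁, h₂⟩

theorem IsRightTriangular.wellFounded_reverses (h : IsRightTriangular R)
    (hc : ∀ a b : PresentedMonoid R, ∃ c d, a * c = b * d) :
    WellFounded fun w' w => Reverses (letterRule R) w w' := by
  refine ⟨fun w => ?_⟩
  obtain ⟨u, v, hw⟩ := h.exists_reverses hc w
  exact acc_of_diamond (fun _ _ _ => h.isChainSystem.reverses_diamond)
    (not_reverses_posWord_append_negWord u v) hw

end triangular

/-! ### Mirror images, exchanging left and right -/

/-- The relations obtained by reading all words from right to left. -/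
def mirror {S : Type*} (R : WordRelations S) : WordRelations S :=
  fun u v => R u.reverse v.reverse

section mirror

variable {S : Type*} {R : WordRelations S}

theorem IsLeftTriangular.mirror (h : IsLeftTriangular R) : IsRightTriangular (mirror R) := by
  obtain ⟨dom, N, C, hN, hC, hac, hR⟩ := h
  refine ⟨dom, N, fun s => (C s).reverse, hN, fun s hs h => hC s hs ?_, hac, fun u v => ?_⟩
  · rw [← FreeMonoid.reverse_reverse (a := C s), show (C s).reverse = 1 from h]
    rfl
  · refine (hR _ _).trans (exists_congr fun s => and_congr_right fun _ => and_congr ?_ ?_)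
    · constructor <;> intro h
      · rw [← FreeMonoid.reverse_reverse (a := u), h, FreeMonoid.reverse_of]
      · rw [h, FreeMonoid.reverse_of]
    · constructor <;> intro h
      · rw [← FreeMonoid.reverse_reverse (a := v), h, FreeMonoid.reverse_mul, FreeMonoid.reverse_of]
      · rw [h, FreeMonoid.reverse_mul, FreeMonoid.reverse_of, FreeMonoid.reverse_reverse]

theorem mirror_mirror : mirror (mirror R) = R := by
  funext u v
  simp [mirror]

theorem conGen_mirror {u v : FreeMonoid S} (h : conGen R u v) :
    conGen (mirror R) u.reverse v.reverse := by
  induction h with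
  | of u v h => exact .of _ _ (by simpa [mirror] using h)
  | refl u => exact .refl _
  | symm _ ih => exact .symm ih
  | trans _ _ ih ih' => exact .trans ih ih'
  | mul _ _ ih ih' =>
    rw [FreeMonoid.reverse_mul, FreeMonoid.reverse_mul]
    exact .mul ih' ih

theorem conGen_mirror_iff {u v : FreeMonoid S} :
    conGen (mirror R) u.reverse v.reverse ↔ conGen R u v := by
  refine ⟨fun h => ?_, conGen_mirror⟩
  simpa [mirror_mirror] using conGen_mirror h

/-- Reading words from right to left, as an anti-isomorphism of monoids. -/
theorem exists_mirror_equiv (R : WordRelations S) :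
    ∃ f : PresentedMonoid R ≃ PresentedMonoid (mirror R), (∀ a b, f (a * b) = f b * f a) ∧
      ∀ s, f (PresentedMonoid.of R s) = PresentedMonoid.of (mirror R) s := by
  let f : PresentedMonoid R → PresentedMonoid (mirror R) :=
    Quotient.lift (fun u : FreeMonoid S => PresentedMonoid.mk (mirror R) u.reverse) fun u v h =>
      PresentedMonoid.mk_eq_mk_iff.2 (conGen_mirror h)
  have hf : ∀ u, f (PresentedMonoid.mk R u) = PresentedMonoid.mk (mirror R) u.reverse :=
    fun u => rfl
  refine ⟨Equiv.ofBijective f ⟨fun a b h => ?_, fun a => ?_⟩, fun a b => ?_, fun s => ?_⟩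
  · obtain ⟨u, rfl⟩ := PresentedMonoid.surjective_mk a
    obtain ⟨v, rfl⟩ := PresentedMonoid.surjective_mk b
    rw [hf, hf, PresentedMonoid.mk_eq_mk_iff, conGen_mirror_iff] at h
    exact PresentedMonoid.mk_eq_mk_iff.2 h
  · obtain ⟨u, rfl⟩ := PresentedMonoid.surjective_mk a
    exact ⟨PresentedMonoid.mk R u.reverse, by rw [hf, FreeMonoid.reverse_reverse]⟩
  · obtain ⟨u, rfl⟩ := PresentedMonoid.surjective_mk a
    obtain ⟨v, rfl⟩ := PresentedMonoid.surjective_mk b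
    change f (PresentedMonoid.mk R u * PresentedMonoid.mk R v) =
      f (PresentedMonoid.mk R v) * f (PresentedMonoid.mk R u)
    rw [← map_mul, hf, hf, hf, FreeMonoid.reverse_mul, map_mul]
  · exact hf _

theorem leftCompletion_iff {u v : FreeMonoid S} :
    leftCompletion R u v ↔ rightCompletion (mirror R) u.reverse v.reverse := by
  constructor
  · intro h
    induction h with
    | base u v h => exact .base _ _ (by simpa [mirror] using h)
    | step s t t' w w' _ h' ih =>
      simpa [FreeMonoid.reverse_mul, mul_assoc] using rightCompletion.step s t t' w.reverse w'.reverse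
          (by simpa [FreeMonoid.reverse_mul] using ih)
        (by simpa [mirror, FreeMonoid.reverse_mul] using h')
  · intro h
    have key : ∀ {u v : FreeMonoid S}, rightCompletion (mirror R) u v →
        leftCompletion R u.reverse v.reverse := by
      intro u v h
      induction h with
      | base u v h => exact .base _ _ h
      | step s t t' w w' _ h' ih =>
        simpa [FreeMonoid.reverse_mul, mul_assoc] using leftCompletion.step s t t' w.reverse w'.reverse
          (by simpa [FreeMonoid.reverse_mul] using ih)
          (by simpa [mirror, FreeMonoid.reverse_mul] using h')
    simpa using key h

theorem posWord_reverse (u : FreeMonoid S) : posWord u.reverse = (posWord u).reverse :=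
  List.map_reverse

theorem negWord_reverse (u : FreeMonoid S) : negWord u.reverse = (negWord u).reverse := by
  simp only [negWord, ← List.map_reverse]
  rfl

/-- Mirroring reverses the order of the letters but keeps their signs, unlike inversion in the
group; thus it turns s' s⁻¹ into s⁻¹ s'. -/
theorem leftReversingStep_iff {w w' : SignedWord S} :
    LeftReversingStep (leftCompletion R) w w' ↔
      RightReversingStep (rightCompletion (mirror R)) w.reverse w'.reverse := by
  constructor
  · intro h
    cases h with
    | rel a b s s' v v' h =>
      have h₁ := RightReversingStep.rel (R := rightCompletion (mirror R)) b.reverse a.reverse s s'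
        v.reverse v'.reverse (by simpa [leftCompletion_iff, FreeMonoid.reverse_mul, or_comm] using h)
      simpa [posWord_reverse, negWord_reverse] using h₁
    | cancel a b s =>
      simpa using RightReversingStep.cancel (R := rightCompletion (mirror R)) b.reverse a.reverse s
  · generalize hx : w.reverse = x
    generalize hy : w'.reverse = y
    intro h
    rw [List.reverse_eq_iff] at hx hy
    subst hx hy
    cases h with
    | rel a b s s' v v' h =>
      have h₁ := LeftReversingStep.rel (R := leftCompletion R) b.reverse a.reverse s s'
        v.reverse v'.reverse (by simpa [leftCompletion_iff, FreeMonoid.reverse_mul, or_comm] using h)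
      simpa [posWord_reverse, negWord_reverse] using h₁
    | cancel a b s =>
      simpa using LeftReversingStep.cancel (R := leftCompletion R) b.reverse a.reverse s

end mirror

/-! ### Closure properties of recursively enumerable predicates -/

namespace REPred

variable {α β : Type*} [Primcodable α] [Primcodable β]

theorem comp {p : β → Prop} (hp : REPred p) {f : α → β} (hf : Computable f) :
    REPred fun a => p (f a) :=
  Partrec.comp hp hf

theorem or {p q : α → Prop} (hp : REPred p) (hq : REPred q) : REPred fun a => p a ∨ q a := by
  obtain ⟨k, hk, h⟩ := Partrec.merge' hp hq
  refine (Partrec.dom_re hk).of_eq fun a => (h a).2.trans ?_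
  simp [Part.dom_iff_mem, Part.mem_assert_iff]

theorem of_exists {f : α → β → Bool} (hf : Computable₂ f) :
    REPred fun a => ∃ b, f a b = true := by
  -- The search runs through all numbers; those that code no element of β count as failures.
  have hg : Computable₂ fun (a : α) (n : ℕ) =>
      (((Encodable.decode (α := β) n).map (f a)).getD false) :=
    Computable.option_getD (Computable.option_map (Computable.decode.comp Computable.snd)
      (hf.comp (Computable.fst.comp Computable.fst) Computable.snd)) (Computable.const false)
  refine (Partrec.dom_re (Partrec.rfind hg.partrec₂)).of_eq fun a => ?_
  simp only [Nat.rfind_dom, PFun.coe_val, Part.mem_some_iff, Part.some_dom, implies_true, and_true]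
  constructor
  · rintro ⟨n, hn⟩
    cases h : (Encodable.decode (α := β) n) with
    | none => simp [h] at hn
    | some b => exact ⟨b, by simpa [h] using hn.symm⟩
  · rintro ⟨b, hb⟩
    exact ⟨Encodable.encode b, by simp [hb]⟩

/-- The number n bounds the computation: evaluation with bounded resources is primitive recursive,
and halting means success for some bound. -/
theorem exists_primrec₂ {p : α → Prop} (hp : REPred p) :
    ∃ f : α → ℕ → Bool, Primrec₂ f ∧ ∀ a, p a ↔ ∃ n, f a n = true := by
  obtain ⟨c, hc⟩ := Nat.Partrec.Code.exists_code.1 hp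
  refine ⟨fun a n => (Nat.Partrec.Code.evaln n c (Encodable.encode a)).isSome, ?_, fun a => ?_⟩
  · exact Primrec.option_isSome.comp (Nat.Partrec.Code.primrec_evaln.comp
      ((Primrec.snd.pair (Primrec.const c)).pair (Primrec.encode.comp Primrec.fst)))
  · have h₁ : p a ↔ (c.eval (Encodable.encode a)).Dom := by
      rw [hc]
      simp [Part.dom_iff_mem, Part.mem_assert_iff]
    rw [h₁, Part.dom_iff_mem]
    simp only [Nat.Partrec.Code.evaln_complete, Option.isSome_iff_exists]
    exact exists_comm

theorem exists_right {p : α × β → Prop} (hp : REPred p) : REPred fun a => ∃ b, p (a, b) := by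
  obtain ⟨f, hf, h⟩ := hp.exists_primrec₂
  refine (of_exists (β := β × ℕ) (f := fun a c => f (a, c.1) c.2) ?_).of_eq fun a => ?_
  · exact hf.to_comp.comp (Computable.fst.pair (Computable.fst.comp Computable.snd))
      (Computable.snd.comp Computable.snd)
  · simp [h]

theorem and {p q : α → Prop} (hp : REPred p) (hq : REPred q) : REPred fun a => p a ∧ q a := by
  refine (Partrec.dom_re (Partrec.bind hp (Partrec.comp hq Computable.fst).to₂)).of_eq fun a => ?_
  simp [Part.dom_iff_mem, Part.mem_assert_iff]

theorem of_primrecPred {p : α → Prop} (hp : PrimrecPred p) : REPred p :=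
  hp.computablePred.to_re

/-- The equivalence relation generated by a recursively enumerable relation is recursively
enumerable. -/
theorem eqvGen [DecidableEq α] {r : α → α → Prop} (hr : REPred fun p : α × α => r p.1 p.2) :
    REPred fun p : α × α => Relation.EqvGen r p.1 p.2 := by
  obtain ⟨f, hf, h⟩ := hr.exists_primrec₂
  -- A move ((b, n), d) proposes to go from a to b, forwards or backwards according to d, with n as
  -- certificate; if the certificate fails, a stays put. So any list of moves traces a valid zigzag,
  -- and each zigzag arises from some list.
  let move : α → (α × ℕ) × Bool → α := fun a c =>
    bif bif c.2 then f (a, c.1.1) c.1.2 else f (c.1.1, a) c.1.2 then c.1.1 else a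
  have hmove : Primrec₂ move := by
    have h₁ : Primrec fun x : α × ((α × ℕ) × Bool) => x.2.1.1 :=
      Primrec.fst.comp (Primrec.fst.comp Primrec.snd)
    have h₂ : Primrec fun x : α × ((α × ℕ) × Bool) => x.2.1.2 :=
      Primrec.snd.comp (Primrec.fst.comp Primrec.snd)
    refine Primrec.cond (Primrec.cond (Primrec.snd.comp Primrec.snd) ?_ ?_) h₁
      Primrec.fst
    · exact hf.comp (Primrec.fst.pair h₁) h₂
    · exact hf.comp (h₁.pair Primrec.fst) h₂
  have hfold : Primrec fun x : (α × α) × List ((α × ℕ) × Bool) => x.2.foldl move x.1.1 :=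
    Primrec.list_foldl Primrec.snd (Primrec.fst.comp Primrec.fst)
      (hmove.comp (Primrec.fst.comp Primrec.snd) (Primrec.snd.comp Primrec.snd)).to₂
  have hRE : REPred fun x : (α × α) × List ((α × ℕ) × Bool) => x.2.foldl move x.1.1 = x.1.2 :=
    of_primrecPred (Primrec.eq.comp hfold (Primrec.snd.comp Primrec.fst))
  refine hRE.exists_right.of_eq fun ⟨a, b⟩ => ?_
  simp only
  have hsound : ∀ a c, Relation.EqvGen r a (move a c) := by
    rintro a ⟨⟨b, n⟩, d⟩
    cases d
    · cases hfb : f (b, a) n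
      · simpa [move, hfb] using .refl a
      · simpa [move, hfb] using .symm _ _ (.rel b a ((h (b, a)).2 ⟨n, hfb⟩))
    · cases hfb : f (a, b) n
      · simpa [move, hfb] using .refl a
      · simpa [move, hfb] using .rel a b ((h (a, b)).2 ⟨n, hfb⟩)
  constructor
  · rintro ⟨l, rfl⟩
    induction l generalizing a with
    | nil => exact .refl a
    | cons c l ih => exact .trans _ _ _ (hsound a c) (ih _)
  · intro hab
    rw [← Relation.EqvGen.reflTransGen_symmGen] at hab
    induction hab using Relation.ReflTransGen.head_induction_on with
    | refl => exact ⟨[], rfl⟩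
    | @head a c hac _ ih =>
      obtain ⟨l, hl⟩ := ih
      rcases hac with hac | hca
      · obtain ⟨n, hn⟩ := (h (a, c)).1 hac
        exact ⟨((c, n), true) :: l, by simpa [move, hn] using hl⟩
      · obtain ⟨n, hn⟩ := (h (c, a)).1 hca
        exact ⟨((c, n), false) :: l, by simpa [move, hn] using hl⟩

end REPred

/-! ### Enumerating the congruence of a monoid presentation -/

section presentation

variable {S : Type*} [Primcodable S]

theorem isREPresentation_of_finite {R : WordRelations S}
    (hR : {p : List S × List S | R (.ofList p.1) (.ofList p.2)}.Finite) :
    IsREPresentation R := by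
  classical
  have h : PrimrecPred fun p : List S × List S => ∃ a ∈ hR.toFinset.toList, a = p :=
    PrimrecRel.comp (PrimrecRel.exists_mem_list Primrec.eq) (Primrec.const _) Primrec.id
  exact (REPred.of_primrecPred h).of_eq fun p => by simp

/-- One application of a relation of `R` inside a word. -/
def WordStep {S : Type*} (R : WordRelations S) (w w' : List S) : Prop :=
  ∃ a b u v, R (.ofList u) (.ofList v) ∧ w = a ++ (u ++ b) ∧ w' = a ++ (v ++ b)

theorem conGen_iff_eqvGen {S : Type*} {R : WordRelations S} {u v : List S} :
    conGen R (.ofList u) (.ofList v) ↔ Relation.EqvGen (WordStep R) u v := by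
  have hcontext : ∀ {u v : List S}, Relation.EqvGen (WordStep R) u v → ∀ a b,
      Relation.EqvGen (WordStep R) (a ++ (u ++ b)) (a ++ (v ++ b)) := by
    intro u v h a b
    induction h with
    | rel _ _ h =>
      obtain ⟨a', b', u, v, h, rfl, rfl⟩ := h
      exact .rel _ _ ⟨a ++ a', b' ++ b, u, v, h, by simp, by simp⟩
    | refl => exact .refl _
    | symm _ _ _ ih => exact .symm _ _ ih
    | trans _ _ _ _ _ ih ih' => exact .trans _ _ _ ih ih'
  constructor
  · suffices ∀ {u v : FreeMonoid S}, conGen R u v →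
        Relation.EqvGen (WordStep R) u.toList v.toList from fun h => this h
    intro u v h
    induction h with
    | of u v h => exact .rel _ _ ⟨[], [], u.toList, v.toList, h, by simp, by simp⟩
    | refl => exact .refl _
    | symm _ ih => exact .symm _ _ ih
    | trans _ _ ih ih' => exact .trans _ _ _ ih ih'
    | mul _ _ ih ih' =>
      exact .trans _ _ _ (by simpa using hcontext ih [] _) (by simpa using hcontext ih' _ [])
  · intro h
    induction h with
    | rel _ _ h =>
      obtain ⟨a, b, u, v, h, rfl, rfl⟩ := h
      exact (conGen R).mul ((conGen R).refl _) ((conGen R).mul (.of _ _ h) ((conGen R).refl _))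
    | refl => exact (conGen R).refl _
    | symm _ _ _ ih => exact (conGen R).symm ih
    | trans _ _ _ _ _ ih ih' => exact (conGen R).trans ih ih'

theorem primrecPred_eq_append_append {α : Type*} [Primcodable α] {f g h k : α → List S}
    (hf : Primrec f) (hg : Primrec g) (hh : Primrec h) (hk : Primrec k) :
    PrimrecPred fun x => f x = g x ++ (h x ++ k x) := by
  classical
  exact Primrec.eq.comp hf (Primrec.list_append.comp hg (Primrec.list_append.comp hh hk))

theorem IsREPresentation.rePred_wordStep {R : WordRelations S} (hR : IsREPresentation R) :
    REPred fun p : List S × List S => WordStep R p.1 p.2 := by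
  let W := List S × List S
  have hw : Primrec fun x : W × (W × W) => x.1.1 := Primrec.fst.comp Primrec.fst
  have hw' : Primrec fun x : W × (W × W) => x.1.2 := Primrec.snd.comp Primrec.fst
  have ha : Primrec fun x : W × (W × W) => x.2.1.1 :=
    Primrec.fst.comp (Primrec.fst.comp Primrec.snd)
  have hb : Primrec fun x : W × (W × W) => x.2.1.2 :=
    Primrec.snd.comp (Primrec.fst.comp Primrec.snd)
  have hu : Primrec fun x : W × (W × W) => x.2.2.1 :=
    Primrec.fst.comp (Primrec.snd.comp Primrec.snd)
  have hv : Primrec fun x : W × (W × W) => x.2.2.2 :=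
    Primrec.snd.comp (Primrec.snd.comp Primrec.snd)
  have h₁ : REPred fun x : W × (W × W) => R (.ofList x.2.2.1) (.ofList x.2.2.2) :=
    REPred.comp hR (Computable.snd.comp Computable.snd)
  have h₂ := REPred.of_primrecPred (primrecPred_eq_append_append hw ha hu hb)
  have h₃ := REPred.of_primrecPred (primrecPred_eq_append_append hw' ha hv hb)
  refine ((h₁.and (h₂.and h₃)).exists_right).of_eq fun p => ?_
  constructor
  · rintro ⟨⟨⟨a, b⟩, u, v⟩, h⟩
    exact ⟨a, b, u, v, h⟩
  · rintro ⟨a, b, u, v, h⟩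
    exact ⟨⟨⟨a, b⟩, u, v⟩, h⟩

/-- The word problem of a recursively enumerable monoid presentation is recursively enumerable. -/
theorem IsREPresentation.rePred_conGen {R : WordRelations S} (hR : IsREPresentation R) :
    REPred fun p : List S × List S => conGen R (.ofList p.1) (.ofList p.2) := by
  classical
  exact hR.rePred_wordStep.eqvGen.of_eq fun p => conGen_iff_eqvGen.symm

end presentation

/-! ### Values of signed words in the group; embedding of the monoid -/

section wordValue

variable {S : Type*} {R : WordRelations S} {G : Type*} [Group G]
  (e : PresentedGroup (groupRelators R) ≃* G)

@[simp] theorem wordValue_nil : wordValue e [] = 1 := by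
  change e (PresentedGroup.mk _ 1) = 1
  rw [map_one, map_one]

@[simp] theorem wordValue_append (w w' : SignedWord S) :
    wordValue e (w ++ w') = wordValue e w * wordValue e w' := by
  rw [wordValue, ← FreeGroup.mul_mk, map_mul, map_mul]
  rfl

theorem wordValue_cons (x : S × Bool) (w : SignedWord S) :
    wordValue e (x :: w) = wordValue e [x] * wordValue e w :=
  wordValue_append e [x] w

@[simp] theorem wordValue_invRev (w : SignedWord S) :
    wordValue e (FreeGroup.invRev w) = (wordValue e w)⁻¹ := by
  rw [wordValue, ← FreeGroup.inv_mk, map_inv, map_inv]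
  rfl

theorem invRev_posWord (u : FreeMonoid S) : FreeGroup.invRev (posWord u) = negWord u := by
  simp [FreeGroup.invRev, posWord, negWord, Function.comp_def]

theorem wordValue_negWord (u : FreeMonoid S) :
    wordValue e (negWord u) = (wordValue e (posWord u))⁻¹ := by
  rw [← invRev_posWord, wordValue_invRev]

theorem wordValue_letter_neg (s : S) :
    wordValue e [(s, false)] = (wordValue e [(s, true)])⁻¹ :=
  wordValue_negWord e (.of s)

theorem wordValue_letter_mul_inv (x : S × Bool) : wordValue e [x, (x.1, !x.2)] = 1 := by
  obtain ⟨s, _ | _⟩ := x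
  · exact (wordValue_cons e (s, false) [(s, true)]).trans
      (by rw [wordValue_letter_neg, inv_mul_cancel])
  · exact (wordValue_cons e (s, true) [(s, false)]).trans
      (by rw [wordValue_letter_neg, mul_inv_cancel])

theorem freeGroup_mk_posWord (u : FreeMonoid S) :
    FreeGroup.mk (posWord u) = FreeMonoid.lift FreeGroup.of u := by
  induction u with
  | one => rfl
  | of s => rfl
  | mul u v hu hv => rw [posWord_mul, ← FreeGroup.mul_mk, hu, hv, map_mul]

theorem wordValue_posWord_eq_of_rel {u v : FreeMonoid S} (h : R u v) :
    wordValue e (posWord u) = wordValue e (posWord v) := by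
  rw [wordValue, wordValue, freeGroup_mk_posWord, freeGroup_mk_posWord]
  exact congrArg e (PresentedGroup.mk_eq_mk_of_mul_inv_mem ⟨u, v, h, rfl⟩)

theorem wordValue_posWord_eq_of_rightCompletion {u v : FreeMonoid S} (h : rightCompletion R u v) :
    wordValue e (posWord u) = wordValue e (posWord v) := by
  induction h with
  | base u v h => exact wordValue_posWord_eq_of_rel e h
  | step s t t' w w' _ h' ih =>
    have h₁ := wordValue_posWord_eq_of_rel e h'
    simp only [posWord_mul, wordValue_append] at ih h₁ ⊢
    rw [h₁, ih, mul_assoc]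

theorem wordValue_posWord_eq_of_leftCompletion {u v : FreeMonoid S} (h : leftCompletion R u v) :
    wordValue e (posWord u) = wordValue e (posWord v) := by
  induction h with
  | base u v h => exact wordValue_posWord_eq_of_rel e h
  | step s t t' w w' _ h' ih =>
    have h₁ := wordValue_posWord_eq_of_rel e h'
    simp only [posWord_mul, wordValue_append] at ih h₁ ⊢
    rw [h₁, ih, mul_assoc]

theorem RightReversingStep.wordValue_eq {w w' : SignedWord S}
    (h : RightReversingStep (rightCompletion R) w w') : wordValue e w = wordValue e w' := by
  cases h with
  | cancel a b s =>
    have h := wordValue_letter_mul_inv e (s, false)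
    simp only [Bool.not_false] at h
    simp only [wordValue_append, h, mul_one]
  | rel a b s s' v v' h =>
    have h₁ : wordValue e (posWord (.of s * v')) = wordValue e (posWord (.of s' * v)) :=
      h.elim (wordValue_posWord_eq_of_rightCompletion e)
        fun h => (wordValue_posWord_eq_of_rightCompletion e h).symm
    simp only [posWord_mul, posWord_of, wordValue_append] at h₁
    have h₂ : wordValue e [(s, false), (s', true)] =
        wordValue e (posWord v') * wordValue e (negWord v) := by
      rw [wordValue_cons, wordValue_letter_neg, wordValue_negWord, inv_mul_eq_iff_eq_mul,
        ← mul_assoc, h₁, mul_inv_cancel_right]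
    simp only [wordValue_append, h₂, mul_assoc]

theorem LeftReversingStep.wordValue_eq {w w' : SignedWord S}
    (h : LeftReversingStep (leftCompletion R) w w') : wordValue e w = wordValue e w' := by
  cases h with
  | cancel a b s =>
    have h := wordValue_letter_mul_inv e (s, true)
    simp only [Bool.not_true] at h
    simp only [wordValue_append, h, mul_one]
  | rel a b s s' v v' h =>
    have h₁ : wordValue e (posWord (v * .of s')) = wordValue e (posWord (v' * .of s)) :=
      h.elim (wordValue_posWord_eq_of_leftCompletion e)
        fun h => (wordValue_posWord_eq_of_leftCompletion e h).symm
    simp only [posWord_mul, posWord_of, wordValue_append] at h₁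
    have h₂ : wordValue e [(s', true), (s, false)] =
        wordValue e (negWord v) * wordValue e (posWord v') := by
      rw [wordValue_cons, wordValue_letter_neg, wordValue_negWord, eq_inv_mul_iff_mul_eq,
        ← mul_assoc, h₁, mul_inv_cancel_right]
    simp only [wordValue_append, h₂, mul_assoc]

/-- A cancellative monoid with common left-multiples embeds in its enveloping group. -/
theorem posWord_value_injective
    (hleft : ∀ a b c : PresentedMonoid R, a * b = a * c → b = c)
    (hright : ∀ a b c : PresentedMonoid R, b * a = c * a → b = c)
    (hmul : ∀ a b : PresentedMonoid R, ∃ c d, c * a = d * b) {u v : FreeMonoid S}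
    (h : wordValue e (posWord u) = wordValue e (posWord v)) :
    PresentedMonoid.mk R u = PresentedMonoid.mk R v := by
  choose f g hfg using hmul
  -- Inverting the whole monoid makes the images of all letters units, so the group maps to the
  -- units of the localization.
  let inst : OreLocalization.OreSet (⊤ : Submonoid (PresentedMonoid R)) :=
    { ore_right_cancel := fun a b s hab => ⟨1, by rw [hright _ _ _ hab]⟩
      oreNum := fun a s => g a s
      oreDenom := fun a s => ⟨f a s, trivial⟩
      ore_eq := fun a s => hfg a s }
  let φ : S → (OreLocalization (⊤ : Submonoid (PresentedMonoid R)) (PresentedMonoid R))ˣ :=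
    fun s => OreLocalization.numeratorUnit ⟨PresentedMonoid.of R s, trivial⟩
  have hφ : ∀ u : FreeMonoid S, ((FreeMonoid.lift φ u : _ˣ) :
      OreLocalization (⊤ : Submonoid (PresentedMonoid R)) (PresentedMonoid R)) =
      OreLocalization.numeratorHom (PresentedMonoid.mk R u) := by
    intro u
    induction u with
    | one => rw [map_one, map_one, map_one, Units.val_one]
    | of s => rfl
    | mul u v hu hv => rw [map_mul, Units.val_mul, hu, hv, map_mul, map_mul]
  have hlift : ∀ u : FreeMonoid S,
      FreeGroup.lift φ (FreeMonoid.lift FreeGroup.of u) = FreeMonoid.lift φ u := by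
    intro u
    induction u with
    | one => simp
    | of s => simp
    | mul u v hu hv => rw [map_mul, map_mul, hu, hv, map_mul]
  have hrel : ∀ r ∈ groupRelators R, FreeGroup.lift φ r = 1 := by
    rintro _ ⟨u, v, huv, rfl⟩
    rw [map_mul, map_inv, hlift, hlift, mul_inv_eq_one]
    apply Units.ext
    rw [hφ, hφ, PresentedMonoid.mk_eq_mk_of_rel huv]
  have hmk : PresentedGroup.mk (groupRelators R) (FreeMonoid.lift FreeGroup.of u) =
      PresentedGroup.mk (groupRelators R) (FreeMonoid.lift FreeGroup.of v) := by
    rw [← freeGroup_mk_posWord, ← freeGroup_mk_posWord]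
    exact e.injective h
  have hval : FreeMonoid.lift φ u = FreeMonoid.lift φ v := by
    rw [← hlift, ← hlift]
    exact congrArg (PresentedGroup.toGroup hrel) hmk
  have hnum := congrArg Units.val hval
  -- Fractions with denominator 1 are equal only if the numerators agree after left multiplication
  -- by a common element, which left cancellation removes.
  rw [hφ, hφ, OreLocalization.numeratorHom_apply, OreLocalization.numeratorHom_apply,
    OreLocalization.oreDiv_eq_iff] at hnum
  obtain ⟨a, b, h₁, h₂⟩ := hnum
  have h₂' : (a : PresentedMonoid R) = b := by simpa using h₂
  refine (hleft b _ _ ?_).symm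
  rw [← h₂']
  simpa [Submonoid.smul_def, ← h₂'] using h₁

/-- The relations of the group presented by `R`, as relations between words in the letters and
their inverses. -/
def signedRelations {S : Type*} (R : WordRelations S) : WordRelations (S × Bool) := fun p q =>
  (∃ u v, R u v ∧ p = .ofList (posWord u) ∧ q = .ofList (posWord v)) ∨
    ∃ x : S × Bool, p = .ofList [x, (x.1, !x.2)] ∧ q = 1

/-- This presents the group as a monoid, so that enumerating the congruence of a monoid presentation
also enumerates equality in the group. -/
theorem conGen_signedRelations_iff {w w' : SignedWord S} :
    conGen (signedRelations R) (.ofList w) (.ofList w') ↔ wordValue e w = wordValue e w' := by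
  constructor
  · suffices ∀ {p q : FreeMonoid (S × Bool)}, conGen (signedRelations R) p q →
        wordValue e p.toList = wordValue e q.toList from this
    intro p q h
    induction h with
    | of p q h =>
      rcases h with ⟨u, v, h, rfl, rfl⟩ | ⟨x, rfl, rfl⟩
      · exact wordValue_posWord_eq_of_rel e h
      · exact (wordValue_letter_mul_inv e x).trans (wordValue_nil e).symm
    | refl => rfl
    | symm _ ih => exact ih.symm
    | trans _ _ ih ih' => exact ih.trans ih'
    | mul _ _ ih ih' => simp [ih, ih']
  · intro h
    have hx : ∀ x : S × Bool, PresentedMonoid.mk (signedRelations R) (.of x) *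
        PresentedMonoid.mk (signedRelations R) (.of (x.1, !x.2)) = 1 := by
      intro x
      rw [← map_mul, ← map_one (PresentedMonoid.mk _)]
      exact PresentedMonoid.mk_eq_mk_of_rel (.inr ⟨x, rfl, rfl⟩)
    let φ : S → (PresentedMonoid (signedRelations R))ˣ := fun s =>
      ⟨PresentedMonoid.mk _ (.of (s, true)), PresentedMonoid.mk _ (.of (s, false)),
        hx (s, true), hx (s, false)⟩
    have hφ : ∀ w : SignedWord S, ((FreeGroup.lift φ (FreeGroup.mk w) : _ˣ) :
        PresentedMonoid (signedRelations R)) = PresentedMonoid.mk _ (.ofList w) := by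
      intro w
      induction w with
      | nil => rfl
      | cons x w ih =>
        rw [← List.singleton_append, ← FreeGroup.mul_mk, map_mul, Units.val_mul, ih,
          FreeMonoid.ofList_append, map_mul]
        congr 1
        obtain ⟨s, _ | _⟩ := x <;> simp [φ]
    have hrel : ∀ r ∈ groupRelators R, FreeGroup.lift φ r = 1 := by
      rintro _ ⟨u, v, huv, rfl⟩
      rw [map_mul, map_inv, mul_inv_eq_one, ← freeGroup_mk_posWord, ← freeGroup_mk_posWord]
      apply Units.ext
      rw [hφ, hφ]
      exact PresentedMonoid.mk_eq_mk_of_rel (.inl ⟨u, v, huv, rfl, rfl⟩)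
    rw [← PresentedMonoid.mk_eq_mk_iff, ← hφ, ← hφ]
    exact congrArg Units.val (congrArg (PresentedGroup.toGroup hrel) (e.injective h))

end wordValue

/-! ### Left-hand versions, and the shape of left-reversed words -/

section mirror

variable {S : Type*} {R : WordRelations S}

theorem PresentedMonoid.exists_common_right_multiple
    (h : ∃ Δ : PresentedMonoid R,
      (∀ s : S, PresentedMonoid.of R s ∣ Δ ∧ Δ ∣ PresentedMonoid.of R s * Δ) ∨
      (∀ (s : S) (n : ℕ), PresentedMonoid.of R s * Δ ^ n ∣ Δ ^ (n + 1)))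
    (a b : PresentedMonoid R) : ∃ c d, a * c = b * d := by
  obtain ⟨Δ, h⟩ := h
  refine _root_.exists_common_right_multiple (PresentedMonoid.closure_range_of R) (Δ := Δ) ?_ a b
  simpa using h

theorem exists_garside_mirror
    (h : ∃ Δ : PresentedMonoid R,
      (∀ s : S, PresentedMonoid.of R s ∣ᵣ Δ ∧ Δ ∣ᵣ Δ * PresentedMonoid.of R s) ∨
      (∀ (s : S) (n : ℕ), Δ ^ n * PresentedMonoid.of R s ∣ᵣ Δ ^ (n + 1))) :
    ∃ Δ : PresentedMonoid (mirror R),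
      (∀ s : S, PresentedMonoid.of _ s ∣ Δ ∧ Δ ∣ PresentedMonoid.of _ s * Δ) ∨
      (∀ (s : S) (n : ℕ), PresentedMonoid.of _ s * Δ ^ n ∣ Δ ^ (n + 1)) := by
  obtain ⟨f, hf, hs⟩ := exists_mirror_equiv R
  obtain ⟨Δ, h⟩ := h
  have hdvd : ∀ {a b}, a ∣ᵣ b → f a ∣ f b := by
    rintro a _ ⟨c, rfl⟩
    exact ⟨f c, hf c a⟩
  have hone : f 1 = 1 := by
    obtain ⟨x, hx⟩ := f.surjective 1
    have h₁ := hf 1 x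
    rwa [one_mul, hx, one_mul, eq_comm] at h₁
  have hpow : ∀ n : ℕ, f (Δ ^ n) = f Δ ^ n := by
    intro n
    induction n with
    | zero => rw [pow_zero, pow_zero, hone]
    | succ n ih => rw [pow_succ, hf, ih, pow_succ']
  refine ⟨f Δ, h.imp (fun h s => ⟨?_, ?_⟩) fun h s n => ?_⟩
  · simpa only [hs] using hdvd (h s).1
  · simpa only [hf, hs] using hdvd (h s).2
  · simpa only [hf, hs, hpow] using hdvd (h s n)

theorem IsLeftTriangular.mul_right_cancel (h : IsLeftTriangular R) {a b c : PresentedMonoid R}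
    (habc : b * a = c * a) : b = c := by
  obtain ⟨f, hf, -⟩ := exists_mirror_equiv R
  refine f.injective (h.mirror.mul_left_cancel (a := f a) ?_)
  rw [← hf, ← hf, habc]

theorem exists_common_left_multiple_of_mirror
    (h : ∀ a b : PresentedMonoid (mirror R), ∃ c d, a * c = b * d) (a b : PresentedMonoid R) :
    ∃ c d, c * a = d * b := by
  obtain ⟨f, hf, -⟩ := exists_mirror_equiv R
  obtain ⟨c, d, hcd⟩ := h (f a) (f b)
  refine ⟨f.symm c, f.symm d, f.injective ?_⟩
  rw [hf, hf, f.apply_symm_apply, f.apply_symm_apply, hcd]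

theorem IsLeftTriangular.leftReversingStep_iff (h : IsLeftTriangular R) {w w' : SignedWord S} :
    LeftReversingStep (leftCompletion R) w w' ↔
      Reverses (letterRule (_root_.mirror R)) w.reverse w'.reverse :=
  _root_.leftReversingStep_iff.trans h.mirror.rightReversingStep_iff

theorem IsLeftTriangular.wellFounded_leftReversingStep (h : IsLeftTriangular R)
    (hc : ∀ a b : PresentedMonoid (_root_.mirror R), ∃ c d, a * c = b * d) :
    WellFounded fun w' w => LeftReversingStep (leftCompletion R) w w' := by
  simp only [h.leftReversingStep_iff]
  exact InvImage.wf List.reverse (h.mirror.wellFounded_reverses hc)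

theorem IsLeftTriangular.exists_leftReversing (h : IsLeftTriangular R)
    (hc : ∀ a b : PresentedMonoid (_root_.mirror R), ∃ c d, a * c = b * d) (w : SignedWord S) :
    ∃ u v : FreeMonoid S, Relation.ReflTransGen (LeftReversingStep (leftCompletion R)) w
      (negWord u ++ posWord v) := by
  obtain ⟨u, v, hw⟩ := h.mirror.exists_reverses hc w.reverse
  refine ⟨u.reverse, v.reverse, ?_⟩
  have h₁ : Relation.ReflTransGen (LeftReversingStep (leftCompletion R)) w.reverse.reverse
      (posWord v ++ negWord u).reverse :=
    hw.lift List.reverse fun a b hab => h.leftReversingStep_iff.2 (by simpa using hab)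
  simpa [posWord_reverse, negWord_reverse] using h₁

theorem posWord_append_negWord_eq {a b u v : FreeMonoid S}
    (h : posWord a ++ negWord b = negWord u ++ posWord v) : u = 1 ∨ v = 1 := by
  by_contra! hne
  obtain ⟨x, u', hu⟩ := List.exists_cons_of_ne_nil (mt negWord_eq_nil.1 hne.1)
  obtain ⟨y, hy⟩ := List.exists_mem_of_ne_nil _ (mt posWord_eq_nil.1 hne.2)
  have hx : x.2 = false := mem_negWord (u := u) (by simp [hu])
  have hy' : y.2 = true := mem_posWord hy
  have hyb : y ∈ posWord a ++ negWord b := by simp [h, hy]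
  rcases ha : posWord a with _ | ⟨z, a'⟩
  · rw [ha, List.nil_append] at hyb
    simp [mem_negWord hyb] at hy'
  · rw [ha, hu, List.cons_append, List.cons_append] at h
    obtain rfl := (List.cons.inj h).1
    have : z.2 = true := mem_posWord (u := a) (by simp [ha])
    simp [this] at hx

/-- Left-reversing a word `v u⁻¹` leads to a positive or a negative word. -/
theorem IsLeftTriangular.eq_one_or_eq_one_of_reflTransGen (h : IsLeftTriangular R)
    {u v u' v' : FreeMonoid S} (hw : Relation.ReflTransGen (LeftReversingStep (leftCompletion R))
      (posWord v ++ negWord u) (negWord u' ++ posWord v')) : u' = 1 ∨ v' = 1 := by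
  have h₁ : Relation.ReflTransGen (Reverses (letterRule (_root_.mirror R)))
      (posWord v ++ negWord u).reverse (negWord u' ++ posWord v').reverse :=
    hw.lift List.reverse fun a b hab => h.leftReversingStep_iff.1 hab
  -- Mirrored, v u⁻¹ has a negative part followed by a positive one, a shape that right-reversing
  -- preserves. Mirrored back, the final word has both shapes.
  rw [List.reverse_append, ← posWord_reverse, ← negWord_reverse] at h₁
  obtain ⟨x, y, hxy⟩ := Reverses.reflTransGen_negWord_append_posWord h₁
  rw [← List.reverse_inj, List.reverse_reverse, List.reverse_append, ← posWord_reverse,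
    ← negWord_reverse] at hxy
  exact posWord_append_negWord_eq hxy.symm

end mirror

/-! ### The ordering and its isolation -/

section order

variable {S : Type*} {R : WordRelations S} {G : Type*} [Group G]
  (e : PresentedGroup (groupRelators R) ≃* G)

theorem DoubleReversing.wordValue_eq {w : SignedWord S} {u v : FreeMonoid S}
    (h : DoubleReversing R w u v) :
    wordValue e w = (wordValue e (posWord u))⁻¹ * wordValue e (posWord v) := by
  obtain ⟨u₀, v₀, h₁, h₂⟩ := h
  have hr : ∀ {w'}, Relation.ReflTransGen (RightReversingStep (rightCompletion R)) w w' →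
      wordValue e w = wordValue e w' := fun h => by
    induction h with
    | refl => rfl
    | tail _ h ih => exact ih.trans (h.wordValue_eq e)
  have hl : ∀ {w₁ w₂}, Relation.ReflTransGen (LeftReversingStep (leftCompletion R)) w₁ w₂ →
      wordValue e w₁ = wordValue e w₂ := fun h => by
    induction h with
    | refl => rfl
    | tail _ h ih => exact ih.trans (h.wordValue_eq e)
  rw [hr h₁, hl h₂, wordValue_append, wordValue_negWord]

theorem subsemigroup_closure_eq :
    (Subsemigroup.closure (Set.range fun s : S => e (PresentedGroup.of s)) : Set G) =
      {g | ∃ u : FreeMonoid S, u ≠ 1 ∧ g = wordValue e (posWord u)} := by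
  ext g
  constructor
  · intro hg
    induction hg using Subsemigroup.closure_induction with
    | mem g hg =>
      obtain ⟨s, rfl⟩ := hg
      exact ⟨.of s, FreeMonoid.of_ne_one s, rfl⟩
    | mul g g' _ _ ih ih' =>
      obtain ⟨u, hu, rfl⟩ := ih
      obtain ⟨u', hu', rfl⟩ := ih'
      exact ⟨u * u', fun h => hu ((List.append_eq_nil_iff.1 h).1), by simp⟩
  · rintro ⟨u, hu, rfl⟩
    induction u using FreeMonoid.inductionOn' with
    | one => exact (hu rfl).elim
    | of_mul s u ih =>
      rw [posWord_mul, wordValue_append]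
      have hs : wordValue e (posWord (.of s)) ∈
          Subsemigroup.closure (Set.range fun s : S => e (PresentedGroup.of s)) :=
        Subsemigroup.subset_closure ⟨s, rfl⟩
      rcases eq_or_ne u 1 with rfl | hne
      · simpa using hs
      · exact mul_mem hs (ih hne)

/-- The left-invariant ordering whose positive cone consists of the values of the nonempty positive
words. -/
def LeftOrder.ofPositiveWords
    (hone : ∀ u : FreeMonoid S, wordValue e (posWord u) = 1 → u = 1)
    (htotal : ∀ g : G, ∃ u : FreeMonoid S,
      g = wordValue e (posWord u) ∨ g⁻¹ = wordValue e (posWord u)) : LeftOrder G where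
  lt a b := ∃ u : FreeMonoid S, u ≠ 1 ∧ a⁻¹ * b = wordValue e (posWord u)
  irrefl a := by
    rintro ⟨u, hu, h⟩
    exact hu (hone u (by rw [← h, inv_mul_cancel]))
  trans a b c := by
    rintro ⟨u, hu, h⟩ ⟨u', -, h'⟩
    refine ⟨u * u', fun h => hu ((List.append_eq_nil_iff.1 h).1), ?_⟩
    rw [posWord_mul, wordValue_append, ← h, ← h']
    group
  total a b := by
    obtain ⟨u, h⟩ := htotal (a⁻¹ * b)
    rcases eq_or_ne u 1 with rfl | hu
    · refine .inr (.inl ?_)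
      simp only [posWord_one, wordValue_nil, inv_eq_one, or_self] at h
      exact inv_mul_eq_one.1 h
    · rcases h with h | h
      · exact .inl ⟨u, hu, h⟩
      · exact .inr (.inr ⟨u, hu, by rw [← h]; group⟩)
  mul_left c a b := by
    rintro ⟨u, hu, h⟩
    exact ⟨u, hu, by rw [← h]; group⟩

/-- Two left-invariant orderings coincide if the positive cone of the first is contained in that of
the second. -/
theorem LeftOrder.eq_of_positiveCone_subset {o o' : LeftOrder G}
    (h : o.positiveCone ⊆ o'.positiveCone) : o' = o := by
  have key : ∀ {a b}, o.lt a b → o'.lt a b := fun {a b} hab => by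
    have h₁ : o'.lt 1 (a⁻¹ * b) := h (show o.lt 1 (a⁻¹ * b) by simpa using o.mul_left a⁻¹ a b hab)
    simpa using o'.mul_left a _ _ h₁
  ext a b
  refine ⟨fun hab => ?_, key⟩
  rcases o.total a b with h₁ | rfl | h₁
  · exact h₁
  · exact (o'.irrefl _ hab).elim
  · exact (o'.irrefl _ (o'.trans _ _ _ hab (key h₁))).elim

/-- An ordering whose positive cone is a finitely generated subsemigroup is isolated. -/
theorem LeftOrder.isOpen_singleton_of_finite {X : Set G} (hX : X.Finite) {o : LeftOrder G}
    (ho : o.positiveCone = Subsemigroup.closure X) : IsOpen ({o} : Set (LeftOrder G)) := by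
  -- An ordering in which all generators are positive has a cone containing that of `o`, hence is
  -- `o`. Finiteness of X then makes this intersection of subbasic sets open.
  have heq : ({o} : Set (LeftOrder G)) = ⋂ g ∈ X, {o' | o'.lt 1 g} := by
    ext o'
    simp only [Set.mem_singleton_iff, Set.mem_iInter, Set.mem_ofPred_eq]
    constructor
    · rintro rfl g hg
      exact ho.ge (Subsemigroup.subset_closure hg)
    · intro h
      refine LeftOrder.eq_of_positiveCone_subset fun g hg => ?_
      rw [ho] at hg
      induction hg using Subsemigroup.closure_induction with
      | mem g hg => exact h g hg
      | mul a b _ _ ha hb =>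
        exact o'.trans 1 a (a * b) ha (by simpa using o'.mul_left a 1 b hb)
  rw [heq]
  exact hX.isOpen_biInter fun g _ => TopologicalSpace.isOpen_generateFrom_of_mem ⟨1, g, rfl⟩

end order

/-! ### Decidability of the word problem and of the ordering -/

section decidability

variable {S : Type*} [Primcodable S] {R : WordRelations S} {G : Type*} [Group G]
  (e : PresentedGroup (groupRelators R) ≃* G)

theorem primrec_map_true : Primrec fun u : List S => u.map fun s => (s, true) :=
  Primrec.list_map Primrec.id (Primrec.snd.pair (Primrec.const true)).to₂

theorem primrec_invRev : Primrec (FreeGroup.invRev : SignedWord S → SignedWord S) :=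
  Primrec.list_reverse.comp (Primrec.list_map Primrec.id
    ((Primrec.fst.comp Primrec.snd).pair (Primrec.not.comp (Primrec.snd.comp Primrec.snd))).to₂)

theorem IsREPresentation.signedRelations (hR : IsREPresentation R) :
    IsREPresentation (signedRelations R) := by
  classical
  let W := SignedWord S × SignedWord S
  have h₁ : REPred fun p : W => ∃ q : List S × List S, R (.ofList q.1) (.ofList q.2) ∧
      p.1 = posWord (.ofList q.1) ∧ p.2 = posWord (.ofList q.2) := by
    have hR' : REPred fun x : W × (List S × List S) => R (.ofList x.2.1) (.ofList x.2.2) :=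
      REPred.comp hR Computable.snd
    have ha : PrimrecPred fun x : W × (List S × List S) => x.1.1 = x.2.1.map fun s => (s, true) :=
      Primrec.eq.comp (Primrec.fst.comp Primrec.fst)
        (primrec_map_true.comp (Primrec.fst.comp Primrec.snd))
    have hb : PrimrecPred fun x : W × (List S × List S) => x.1.2 = x.2.2.map fun s => (s, true) :=
      Primrec.eq.comp (Primrec.snd.comp Primrec.fst)
        (primrec_map_true.comp (Primrec.snd.comp Primrec.snd))
    exact (hR'.and ((REPred.of_primrecPred ha).and (REPred.of_primrecPred hb))).exists_right
  have h₂ : REPred fun p : W => ∃ x : S × Bool, p.1 = [x, (x.1, !x.2)] ∧ p.2 = [] := by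
    have ha : PrimrecPred fun y : W × (S × Bool) => y.1.1 = [y.2, (y.2.1, !y.2.2)] :=
      Primrec.eq.comp (Primrec.fst.comp Primrec.fst) <|
        Primrec.list_cons.comp Primrec.snd <| Primrec.list_cons.comp
          ((Primrec.fst.comp Primrec.snd).pair (Primrec.not.comp (Primrec.snd.comp Primrec.snd)))
          (Primrec.const [])
    have hb : PrimrecPred fun y : W × (S × Bool) => y.1.2 = [] :=
      Primrec.eq.comp (Primrec.snd.comp Primrec.fst) (Primrec.const [])
    exact ((REPred.of_primrecPred ha).and (REPred.of_primrecPred hb)).exists_right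
  refine (h₁.or h₂).of_eq fun p => or_congr ⟨?_, ?_⟩ Iff.rfl
  · rintro ⟨q, h⟩
    exact ⟨_, _, h⟩
  · rintro ⟨u, v, h⟩
    exact ⟨(u.toList, v.toList), h⟩

theorem IsREPresentation.rePred_wordValue_eq (hR : IsREPresentation R) :
    REPred fun p : SignedWord S × SignedWord S => wordValue e p.1 = wordValue e p.2 :=
  hR.signedRelations.rePred_conGen.of_eq fun _ => conGen_signedRelations_iff e

theorem IsREPresentation.rePred_wordValue_mem (hR : IsREPresentation R) :
    REPred fun w : SignedWord S =>
      ∃ u : FreeMonoid S, u ≠ 1 ∧ wordValue e w = wordValue e (posWord u) := by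
  classical
  have h₁ : REPred fun x : SignedWord S × List S =>
      wordValue e x.1 = wordValue e (posWord (.ofList x.2)) :=
    (hR.rePred_wordValue_eq e).comp
      (Primrec.fst.pair (primrec_map_true.comp Primrec.snd)).to_comp
  have h₂ : PrimrecPred fun x : SignedWord S × List S => ¬ x.2 = [] :=
    (Primrec.eq.comp Primrec.snd (Primrec.const [])).not
  exact ((REPred.of_primrecPred h₂).and h₁).exists_right

/-- Word problem and decision problem, for an ordering whose positive cone consists of the values of
the nonempty positive words. -/
theorem IsREPresentation.computablePred (hR : IsREPresentation R) {o : LeftOrder G}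
    (ho : o.positiveCone = {g | ∃ u : FreeMonoid S, u ≠ 1 ∧ g = wordValue e (posWord u)}) :
    ComputablePred (fun w : SignedWord S => wordValue e w = 1) ∧
      ComputablePred (fun p : SignedWord S × SignedWord S =>
        o.lt (wordValue e p.1) (wordValue e p.2)) := by
  have hpos : REPred fun w : SignedWord S => o.lt 1 (wordValue e w) :=
    (hR.rePred_wordValue_mem e).of_eq fun w => (Set.ext_iff.1 ho (wordValue e w)).symm
  have hneg : REPred fun w : SignedWord S => o.lt (wordValue e w) 1 := by
    refine (hpos.comp primrec_invRev.to_comp).of_eq fun w => ?_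
    rw [wordValue_invRev]
    constructor
    · intro h
      simpa using o.mul_left (wordValue e w) _ _ h
    · intro h
      simpa using o.mul_left (wordValue e w)⁻¹ _ _ h
  have hone : REPred fun w : SignedWord S => wordValue e w = 1 :=
    ((hR.rePred_wordValue_eq e).comp
      (Computable.id.pair (Computable.const []))).of_eq fun w => by simp
  have hcpos : ComputablePred fun w : SignedWord S => o.lt 1 (wordValue e w) := by
    -- Post's theorem: by trichotomy the complement of the cone is the union of two enumerable sets,
    -- and likewise below for the word problem.
    refine ComputablePred.computable_iff_re_compl_re'.2 ⟨hpos, (hone.or hneg).of_eq fun w => ?_⟩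
    constructor
    · rintro (h | h) h'
      · exact o.irrefl _ (h ▸ h')
      · exact o.irrefl _ (o.trans _ _ _ h h')
    · intro h
      rcases o.total 1 (wordValue e w) with h₁ | h₁ | h₁
      · exact (h h₁).elim
      · exact .inl h₁.symm
      · exact .inr h₁
  refine ⟨ComputablePred.computable_iff_re_compl_re'.2 ⟨hone, (hpos.or hneg).of_eq fun w => ?_⟩, ?_⟩
  · constructor
    · rintro (h | h) h' <;> exact o.irrefl _ (h' ▸ h)
    · intro h
      rcases o.total 1 (wordValue e w) with h₁ | h₁ | h₁
      · exact .inl h₁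
      · exact (h h₁.symm).elim
      · exact .inr h₁
  -- By left-invariance, comparing two words amounts to testing whether [w₁]⁻¹[w₂] is positive.
  · have hf : Computable fun p : SignedWord S × SignedWord S => FreeGroup.invRev p.1 ++ p.2 :=
      Computable.list_append.comp (primrec_invRev.to_comp.comp Computable.fst) Computable.snd
    obtain ⟨f, hf', hfeq⟩ := ComputablePred.computable_iff.1 hcpos
    refine (ComputablePred.computable_iff.2 ⟨_, hf'.comp hf, rfl⟩).of_eq fun p => ?_
    refine (iff_of_eq (congrFun hfeq _)).symm.trans ?_
    simp only [wordValue_append, wordValue_invRev]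
    constructor
    · intro h
      simpa using o.mul_left (wordValue e p.1) _ _ h
    · intro h
      simpa using o.mul_left (wordValue e p.1)⁻¹ _ _ h

end decidability

theorem IsRightTriangular.finite {S : Type*} [Finite S] {R : WordRelations S}
    (h : IsRightTriangular R) :
    {p : List S × List S | R (.ofList p.1) (.ofList p.2)}.Finite := by
  obtain ⟨dom, N, C, -, -, -, hR⟩ := h
  refine (Set.finite_range fun s : S => (([N s], s :: (C s).toList) : List S × List S)).subset ?_
  rintro ⟨u, v⟩ huv
  obtain ⟨s, -, hu, hv⟩ := (hR _ _).1 huv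
  exact ⟨s, Prod.ext hu.symm hv.symm⟩

theorem theorem6p5 {S : Type*} (R : WordRelations S) (hR : IsTriangular R)
    {G : Type*} [Group G] (e : PresentedGroup (groupRelators R) ≃* G)
    (hΔ : ∃ Δ : PresentedMonoid R,
      (∀ s : S, PresentedMonoid.of R s ∣ Δ ∧ Δ ∣ PresentedMonoid.of R s * Δ) ∨
      (∀ (s : S) (n : ℕ), PresentedMonoid.of R s * Δ ^ n ∣ Δ ^ (n + 1)))
    (hΔ' : ∃ Δ' : PresentedMonoid R,
      (∀ s : S, PresentedMonoid.of R s ∣ᵣ Δ' ∧ Δ' ∣ᵣ Δ' * PresentedMonoid.of R s) ∨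
      (∀ (s : S) (n : ℕ), Δ' ^ n * PresentedMonoid.of R s ∣ᵣ Δ' ^ (n + 1))) :
    ∃ o : LeftOrder G,
      o.positiveCone =
        (Subsemigroup.closure (Set.range fun s : S => e (PresentedGroup.of s)) : Set G) ∧
      (Finite S → IsOpen ({o} : Set (LeftOrder G))) ∧
      DoubleReversingDecides R (wordValue e) o ∧
      ∀ [Primcodable S], (Finite S ∨ IsREPresentation R) →
        ComputablePred (fun w : SignedWord S => wordValue e w = 1) ∧
        ComputablePred (fun p : SignedWord S × SignedWord S =>
          o.lt (wordValue e p.1) (wordValue e p.2)) := by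
  obtain ⟨hr, hl⟩ := hR
  have hcr := PresentedMonoid.exists_common_right_multiple hΔ
  have hcl := PresentedMonoid.exists_common_right_multiple (exists_garside_mirror hΔ')
  -- By the embedding, u is already trivial in the monoid; but a derivation never makes a nonempty
  -- word empty.
  have hone : ∀ u : FreeMonoid S, wordValue e (posWord u) = 1 → u = 1 := fun u hu =>
    hr.mk_eq_one <| (posWord_value_injective e (fun _ _ _ => hr.mul_left_cancel)
      (fun _ _ _ => hl.mul_right_cancel) (exists_common_left_multiple_of_mirror hcl)
      (hu.trans (wordValue_nil e).symm : _ = wordValue e (posWord 1))).trans (map_one _)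
  have hstep : RightReversingStep (rightCompletion R) = Reverses (letterRule R) :=
    funext₂ fun _ _ => propext hr.rightReversingStep_iff
  have hrtotal : ∀ w, ∃ u v : FreeMonoid S,
      Relation.ReflTransGen (RightReversingStep (rightCompletion R)) w (posWord v ++ negWord u) :=
    hstep ▸ hr.exists_reverses hcr
  have hltotal := hl.exists_leftReversing hcl
  have hcases : ∀ {w u v}, DoubleReversing R w u v →
      (v = 1 ∧ (wordValue e w)⁻¹ = wordValue e (posWord u)) ∨
        (u = 1 ∧ wordValue e w = wordValue e (posWord v)) := fun {w u v} h => by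
    have hval := h.wordValue_eq e
    obtain ⟨_, _, -, h₂⟩ := h
    rcases hl.eq_one_or_eq_one_of_reflTransGen h₂ with rfl | rfl
    · exact .inr ⟨rfl, by simpa using hval⟩
    · exact .inl ⟨rfl, by simpa using congrArg (·⁻¹) hval⟩
  -- Totality comes from running the double reversing procedure on any word representing g.
  have htotal : ∀ g : G, ∃ u : FreeMonoid S,
      g = wordValue e (posWord u) ∨ g⁻¹ = wordValue e (posWord u) := fun g => by
    obtain ⟨x, hx⟩ := PresentedGroup.mk_surjective _ (e.symm g)
    obtain ⟨w, rfl⟩ := Quot.exists_rep x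
    have hw : wordValue e w = g := (congrArg e hx).trans (e.apply_symm_apply g)
    obtain ⟨u, v, h₁⟩ := hrtotal w
    obtain ⟨u', v', h₂⟩ := hltotal (posWord v ++ negWord u)
    rcases hcases ⟨u, v, h₁, h₂⟩ with ⟨-, h⟩ | ⟨-, h⟩
    · exact ⟨u', .inr (hw ▸ h)⟩
    · exact ⟨v', .inl (hw ▸ h)⟩
  let o := LeftOrder.ofPositiveWords e hone htotal
  have ho : o.positiveCone = {g | ∃ u : FreeMonoid S, u ≠ 1 ∧ g = wordValue e (posWord u)} := by
    ext g
    change (∃ u : FreeMonoid S, u ≠ 1 ∧ 1⁻¹ * g = wordValue e (posWord u)) ↔ _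
    rw [inv_one, one_mul]
    rfl
  have ho' := ho.trans (subsemigroup_closure_eq e).symm
  refine ⟨o, ho', fun _ => LeftOrder.isOpen_singleton_of_finite (Set.finite_range _) ho', ?_, ?_⟩
  · refine ⟨?_, hl.wellFounded_leftReversingStep hcl, hrtotal, hltotal, fun w u v h => ?_⟩
    · exact hstep ▸ hr.wellFounded_reverses hcr
    · rcases hcases h with ⟨rfl, hval⟩ | ⟨rfl, hval⟩
      · rcases eq_or_ne u 1 with rfl | hu
        · exact .inr (.inl ⟨rfl, rfl, by simpa using hval⟩)
        · exact .inl ⟨hu, rfl, u, hu, by rw [mul_one, hval]⟩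
      · rcases eq_or_ne v 1 with rfl | hv
        · exact .inr (.inl ⟨rfl, rfl, by simpa using hval⟩)
        · exact .inr (.inr ⟨rfl, hv, v, hv, by rw [inv_one, one_mul, hval]⟩)
  · intro _ hfin
    have hRE : IsREPresentation R :=
      hfin.elim (fun _ => isREPresentation_of_finite hr.finite) id
    exact hRE.computablePred e ho
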